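/- **Definitions.** Let $V$ be a complex Banach space and $\Omega\subset V$ open. For $u:\Omega\to\mathbb C$ put $du(z;\xi)=\lim_{\mathbb R\ni t\to0}(u(z+t\xi)-u(z))/t$. Let $C^0(\Omega)$ be the continuous functions and say $u\in C^{m+1}(\Omega)$ if $du(z;\xi)$ exists for all $z\in\Omega$, $\xi\in V$ and $du\in C^m(\Omega\times V)$. A $(0,1)$-form on $\Omega$ is a function $f:\Omega\times V\to\mathbb C$, $(z,\xi)\mapsto f(z;\xi)$, that is conjugate-linear in $\xi$; it is of class $C^m$, $f\in C^m_{0,1}(\Omega)$, if it is $C^m$ as a function on $\Omega\times V$. For $A\subset\Omega$ put $|f|_{0,A}=\sup\{|f(z;\xi)|: z\in A,\ \|\xi\|<1\}$. For continuous $f$, the form $f$ is $\bar\partial$-closed if for every finite dimensional complex subspace $F\subset V$ one has $\bar\partial(f|_F)=0$ on $\Omega\cap F$ in the sense of distributions; the equation $\bar\partial u=f$ is solvable on $\Omega$ if there is a continuous $u:\Omega\to\mathbb C$ such that for every finite dimensional complex subspace $F\subset V$ one has $\bar\partial(u|_F)=f|_F$ on $\Omega\cap F$ in the sense of distributions. **Theorem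 9.1.** Let $p\in\{1,2,\dots\}$, let $l^p$ be the complex Banach space of $p$-summable sequences $z=(z_\nu)$, and $B(r)=\{z\in l^p:\|z\|<r\}$. There is a $\bar\partial$-closed form $f\in C^{p-1}_{0,1}(l^p)$ with $$|f|_{0,B(r)}\le r^{p-1}\qquad\text{for all } r>0,$$ such that $\bar\partial u=f$ is not solvable on any nonempty open set $\Omega\subset l^p$. Moreover $f$ can be chosen of the form $$f(z;\xi)=\sum_\nu\varphi(z_\nu)\,\overline{\xi_\nu}\qquad (z,\xi\in l^p),$$ where $\varphi(0)=0$ and $\varphi=\partial\lambda/\partial\bar\zeta$ on $\mathbb C\setminus\{0\}$ for some compactly supported function $\lambda:\mathbb C\to\mathbb C$ that is $C^p$ on $\mathbb C\setminus\{0\}$ and satisfies $\lambda(0)=0$ and $\lambda(\zeta)=\zeta^p\log\log|\zeta|^{-2}$ for all $\zeta\neq0$ in a neighborhood of $0$. -/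

import Mathlib

open MeasureTheory Set Filter Topology
open scoped ENNReal ContDiff

noncomputable section

universe u

/-- `u` is of class `C^m` on the open set `Ω`: `C^0` means continuous, and `u` is `C^(m+1)` if the
directional derivative `du(z; ξ) = lim (u(z + tξ) - u(z)) / t` (`t → 0` real) exists for all
`z ∈ Ω`, `ξ ∈ V` and `du` is of class `C^m` on `Ω × V`. -/
def IsClassC : ℕ → {V : Type u} → [NormedAddCommGroup V] → [NormedSpace ℝ V] →
    Set V → (V → ℂ) → Prop
  | 0, _, _, _, Ω, u => ContinuousOn u Ω
  | m + 1, V, _, _, Ω, u =>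
      (∀ z ∈ Ω, ∀ ξ : V, LineDifferentiableAt ℝ u z ξ) ∧
        IsClassC m (Ω ×ˢ (univ : Set V)) (fun q : V × V => lineDeriv ℝ u q.1 q.2)

/-- A `(0,1)`-form on `V`: a function `(z, ξ) ↦ f(z; ξ)` that is conjugate-linear in `ξ`. -/
abbrev Form01 (V : Type u) [NormedAddCommGroup V] [NormedSpace ℂ V] : Type u :=
  V → V →ₗ⋆[ℂ] ℂ

section Forms

variable {V : Type u} [NormedAddCommGroup V] [NormedSpace ℂ V]

/-- A `(0,1)`-form is of class `C^m` on `Ω` if it is so as a function on `Ω × V`. -/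
def Form01.IsClassC (m : ℕ) (Ω : Set V) (f : Form01 V) : Prop :=
  _root_.IsClassC m (Ω ×ˢ (univ : Set V)) (fun q : V × V => f q.1 q.2)

/-- The quantity `|f|_{0,A}`, the supremum of `|f(z; ξ)|` over `z ∈ A` and `ξ` in the unit ball;
it is `∞` if `f` is not bounded there. -/
def Form01.supNorm (f : Form01 V) (A : Set V) : ℝ≥0∞ :=
  ⨆ z ∈ A, ⨆ ξ ∈ Metric.ball (0 : V) 1, ‖f z ξ‖ₑ

/-- The pointwise `∂̄` of a differentiable function: the value at `ξ` of the conjugate-linear part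
of the real differential, `∂̄g(z; ξ) = (dg(z; ξ) + i dg(z; iξ)) / 2`. On `ℂ` with `ξ = 1` this is
`∂g/∂ζ̄`; on `ℂ^n` with `ξ = e_j` it is `∂g/∂w̄_j`. -/
def dbar (g : V → ℂ) (z ξ : V) : ℂ :=
  (1 / 2) * (fderiv ℝ g z ξ + Complex.I * fderiv ℝ g z (Complex.I • ξ))

/-- Test functions on an open subset `D` of `ℂ^n`: smooth with compact support contained in `D`. -/
def IsTestFunction {n : ℕ} (D : Set (Fin n → ℂ)) (g : (Fin n → ℂ) → ℂ) : Prop :=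
  ContDiff ℝ ∞ g ∧ HasCompactSupport g ∧ tsupport g ⊆ D

/-- `∂̄u = f` on `Ω` in the weak sense: for every finite dimensional complex subspace `F` of `V`
(given as the image of a linear embedding `L` of `ℂ^n`), `∂̄(u|_F) = f|_F` on `Ω ∩ F` as
distributions, that is, `∂(u ∘ L)/∂w̄_j = f(L w; L e_j)` on `L⁻¹(Ω)` for all `j`. -/
def IsWeakDbarSolution (Ω : Set V) (f : Form01 V) (u : V → ℂ) : Prop :=
  ∀ (n : ℕ) (L : (Fin n → ℂ) →ₗ[ℂ] V), Function.Injective L →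
    ∀ g : (Fin n → ℂ) → ℂ, IsTestFunction (L ⁻¹' Ω) g →
      ∀ j : Fin n,
        ∫ w, u (L w) * dbar g w (Pi.single j 1) =
          -∫ w, f (L w) (L (Pi.single j 1)) * g w

/-- The equation `∂̄u = f` is solvable on `Ω`: it has a continuous weak solution there. -/
def DbarSolvableOn (Ω : Set V) (f : Form01 V) : Prop :=
  ∃ u : V → ℂ, ContinuousOn u Ω ∧ IsWeakDbarSolution Ω f u

/-- The `(0,1)`-form `f` is `∂̄`-closed on `Ω`: for every finite dimensional complex subspace `F`
of `V` (given as the image of a linear embedding `L` of `ℂ^n`), `∂̄(f|_F) = 0` on `Ω ∩ F` as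
distributions, that is, `∂f_j/∂w̄_k = ∂f_k/∂w̄_j` on `L⁻¹(Ω)`, where `f_j(w) = f(L w; L e_j)`. -/
def Form01.IsDbarClosed (Ω : Set V) (f : Form01 V) : Prop :=
  ∀ (n : ℕ) (L : (Fin n → ℂ) →ₗ[ℂ] V), Function.Injective L →
    ∀ g : (Fin n → ℂ) → ℂ, IsTestFunction (L ⁻¹' Ω) g →
      ∀ j k : Fin n,
        ∫ w, f (L w) (L (Pi.single j 1)) * dbar g w (Pi.single k 1) =
          ∫ w, f (L w) (L (Pi.single k 1)) * dbar g w (Pi.single j 1)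

end Forms

end

open scoped ComplexConjugate

/-! Take `λ(ζ) = ζ^p H(log |ζ|⁻²)`, where `H` is a smooth cutoff of the logarithm with `|H'| ≤ 1`,
and `φ = ∂λ/∂ζ̄ = -ζ^p ζ̄⁻¹ H'(log |ζ|⁻²)`. The double logarithm disappears in `φ`: one has `|φ(ζ)|
≤ |ζ|^(p-1)`, so `f = ∑ φ(z_ν) ξ̄_ν` converges on `ℓ^p` with the required growth. Formally `f` is
`∂̄` of `∑ λ(z_ν)`, but the unbounded factor `log log` prevents that sum from defining a function
near any point.

Regularity: derivatives of `φ` of order `k ≤ p - 1` are `O(|ζ|^(p-1-k))`, so `φ(ζ) ξ̄` is of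
homogeneous order `p` in `(ζ, ξ)`, and such series over the coordinates of `ℓ^p` may be
differentiated term by term (`IsPowerSummable.isClassC`). Closedness: on a finite dimensional
subspace each term of `f` is weakly `∂̄(λ ∘ ℓ)` with `ℓ` linear
(`IsLogCutoff.integral_powMulLog_mul_dbar`).

Non-solvability: a continuous solution `u` satisfies `|u| ≤ M` on a ball of radius `r` about a
finitely supported point. Restrict it to `m^p` unused coordinates. By Weyl's lemma `u - ∑ λ(w_i)` is
holomorphic there, up to a constant, on the `ℓ^p` ball of radius `r`, which contains the polydisc of
radius `r/m`. Rotating the coordinates by `p`-th roots of unity and averaging kills every mixed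
monomial of degree `p`, so the averaged `p`-th Taylor coefficient on diagonals is the sum of those
on the axes (`sum_circleCoeff_diagonal_eq`). With `ρ < r`, diagonals are measured on the circle of
radius `ρ/m` and axes on that of radius `ρ`. After division by the `m^p` coordinates, `u`
contributes at most `2M/ρ^p` and `λ` contributes `H(log (ρ/m)⁻²)` against `H(log ρ⁻²)`
(`log_cutoff_le_of_holomorphic_sub`). The first of these tends to infinity with `m`, a
contradiction. -/

/-! ### The cutoff logarithm and decaying profiles. -/

/-- A smooth function that vanishes on `(-∞, 1]`, is the logarithm near `+∞` and has derivative at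
most one in absolute value. -/
theorem exists_smooth_log_cutoff : ∃ H : ℝ → ℝ, ContDiff ℝ ∞ H ∧ (∀ t ≤ 1, H t = 0) ∧
    (∀ᶠ t in atTop, H t = Real.log t) ∧ ∀ t, |deriv H t| ≤ 1 := by
  obtain ⟨C, hC⟩ := (isCompact_Icc (a := (-1 : ℝ)) (b := 2)).exists_bound_of_continuousOn
    (f := deriv Real.smoothTransition)
    ((Real.smoothTransition.contDiff (n := 1)).continuous_deriv le_rfl).continuousOn
  have hC0 : 0 ≤ C := (norm_nonneg _).trans (hC 0 (by norm_num))
  -- The cutoff is `σ(t/a - 1) log t` with `σ` the smooth transition. Its derivative is at most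
  -- `1/a` from the logarithm plus `C log(3a)/a` from `σ'`, so a transition on a long interval `[a,
  -- 2a]` keeps the slope below one.
  obtain ⟨a, ha1, ha⟩ : ∃ a : ℝ, 2 ≤ a ∧ 1 / a + C * (Real.log (3 * a) / a) ≤ 1 := by
    have h1 : Tendsto (fun a : ℝ => 1 / a + C * (Real.log (3 * a) / a)) atTop (𝓝 (0 + C * 0)) := by
      refine Tendsto.add ?_ (Tendsto.const_mul _ ?_)
      · exact tendsto_const_nhds.div_atTop tendsto_id
      · have h2 : Tendsto (fun a : ℝ => 3 * (Real.log (3 * a) / (3 * a))) atTop (𝓝 (3 * 0)) := by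
          refine Tendsto.const_mul _ ?_
          have h3 := Real.isLittleO_log_id_atTop.tendsto_div_nhds_zero
          exact h3.comp (tendsto_id.const_mul_atTop (by norm_num : (0 : ℝ) < 3))
        rw [mul_zero] at h2
        refine h2.congr' ?_
        filter_upwards [eventually_gt_atTop 0] with a ha
        field_simp
    rw [mul_zero, add_zero] at h1
    obtain ⟨a, h, h'⟩ := ((h1.eventually (gt_mem_nhds zero_lt_one)).and
      (eventually_ge_atTop 2)).exists
    exact ⟨a, h', h.le⟩
  have ha0 : 0 < a := by linarith
  have hσ : ContDiff ℝ ∞ fun t : ℝ => Real.smoothTransition (t / a - 1) :=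
    Real.smoothTransition.contDiff.comp (by fun_prop)
  have hzero : ∀ t ≤ a, Real.smoothTransition (t / a - 1) = 0 := fun t ht =>
    Real.smoothTransition.zero_of_nonpos (by
      have := (div_le_one ha0).2 ht
      linarith)
  have hone : ∀ t, 2 * a ≤ t → Real.smoothTransition (t / a - 1) = 1 := fun t ht =>
    Real.smoothTransition.one_of_one_le (by
      have := (le_div_iff₀ ha0).2 ht
      linarith)
  refine ⟨fun t => Real.smoothTransition (t / a - 1) * Real.log t, ?_, ?_, ?_, ?_⟩
  · rw [contDiff_iff_contDiffAt]
    intro t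
    rcases lt_or_ge t a with ht | ht
    · refine (contDiffAt_const (c := (0 : ℝ))).congr_of_eventuallyEq ?_
      filter_upwards [gt_mem_nhds ht] with s hs
      simp [hzero s (le_of_lt hs)]
    · exact hσ.contDiffAt.mul (Real.contDiffAt_log.2 (by linarith))
  · intro t ht
    simp [hzero t (by linarith)]
  · filter_upwards [eventually_ge_atTop (2 * a)] with t ht
    simp [hone t ht]
  · intro t
    rcases lt_or_ge t a with ht | ht
    · have : (fun t => Real.smoothTransition (t / a - 1) * Real.log t) =ᶠ[𝓝 t] fun _ => 0 := by
        filter_upwards [gt_mem_nhds ht] with s hs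
        simp [hzero s (le_of_lt hs)]
      rw [this.deriv_eq]
      simp
    have ht0 : 0 < t := by linarith
    rcases lt_or_ge (2 * a) t with ht2 | ht2
    · have : (fun t => Real.smoothTransition (t / a - 1) * Real.log t) =ᶠ[𝓝 t] Real.log := by
        filter_upwards [lt_mem_nhds ht2] with s hs
        simp [hone s (le_of_lt hs)]
      rw [this.deriv_eq, Real.deriv_log, abs_inv, abs_of_pos ht0]
      exact inv_le_one_of_one_le₀ (by linarith)
    · have h1 : HasDerivAt (fun t : ℝ => Real.smoothTransition (t / a - 1))
          (deriv Real.smoothTransition (t / a - 1) * (1 / a)) t :=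
        ((Real.smoothTransition.contDiff (n := 1)).differentiable one_ne_zero
          _).hasDerivAt.comp t (((hasDerivAt_id t).div_const a).sub_const 1)
      have h2 := h1.mul (Real.hasDerivAt_log ht0.ne')
      have h2' : deriv (fun t => Real.smoothTransition (t / a - 1) * Real.log t) t = _ := h2.deriv
      rw [h2']
      refine (abs_add_le _ _).trans (le_trans ?_ ha)
      rw [add_comm]
      refine add_le_add ?_ ?_
      · rw [abs_mul, abs_of_nonneg (Real.smoothTransition.nonneg _), abs_inv, abs_of_pos ht0,
          one_div]
        exact (mul_le_of_le_one_left (inv_nonneg.2 ht0.le) (Real.smoothTransition.le_one _)).trans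
          (inv_anti₀ ha0 ht)
      · have h3 : |deriv Real.smoothTransition (t / a - 1)| ≤ C := by
          refine hC _ ⟨?_, ?_⟩
          · have := div_nonneg ht0.le ha0.le
            linarith
          · have := (div_le_iff₀ ha0).2 ht2
            linarith
        have h4 : |Real.log t| ≤ Real.log (3 * a) := by
          rw [abs_of_nonneg (Real.log_nonneg (by linarith))]
          exact Real.log_le_log ht0 (by linarith)
        rw [abs_mul, abs_mul, abs_of_pos (one_div_pos.2 ha0)]
        calc _ ≤ C * (1 / a) * Real.log (3 * a) := by gcongr
          _ = _ := by ring

/-- The smooth functions that vanish on `(-∞, 1)` and tend to zero at `+∞` with all their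
derivatives. -/
structure IsDecayingProfile (K : ℝ → ℝ) : Prop where
  contDiff : ContDiff ℝ ∞ K
  eq_zero : ∀ t < 1, K t = 0
  tendsto : ∀ n, Tendsto (iteratedDeriv n K) atTop (𝓝 0)

namespace IsDecayingProfile

variable {K : ℝ → ℝ}

theorem deriv (hK : IsDecayingProfile K) : IsDecayingProfile (deriv K) where
  contDiff := (contDiff_infty_iff_deriv.1 hK.contDiff).2
  eq_zero t ht := by
    have : K =ᶠ[𝓝 t] fun _ => 0 := by
      filter_upwards [gt_mem_nhds ht] with s hs using hK.eq_zero s hs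
    rw [this.deriv_eq]
    simp
  tendsto n := by
    rw [← iteratedDeriv_succ']
    exact hK.tendsto (n + 1)

/-- This is what `∂/∂ζ` (with `c = a`) and `∂/∂ζ̄` (with `c = b`) do to the profile `K` in `ζ^a ζ̄^b
K(log |ζ|⁻²)`; closure under it drives the inductions on the order of differentiation. -/
theorem const_mul_sub_deriv (hK : IsDecayingProfile K) (c : ℝ) :
    IsDecayingProfile (fun t => c * K t - _root_.deriv K t) where
  contDiff := (contDiff_const.mul hK.contDiff).sub hK.deriv.contDiff
  eq_zero t ht := by rw [hK.eq_zero t ht, hK.deriv.eq_zero t ht]; simp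
  tendsto n := by
    have h1 : ContDiff ℝ n K := hK.contDiff.of_le (by exact_mod_cast le_top)
    have h2 : ContDiff ℝ n (_root_.deriv K) := hK.deriv.contDiff.of_le (by exact_mod_cast le_top)
    have h : iteratedDeriv n (fun t => c * K t - _root_.deriv K t) =
        fun t => c * iteratedDeriv n K t - iteratedDeriv n (_root_.deriv K) t := by
      ext t
      rw [iteratedDeriv_fun_sub (contDiff_const.mul h1).contDiffAt h2.contDiffAt,
        iteratedDeriv_const_mul_field]
    rw [h]
    simpa using ((hK.tendsto n).const_mul c).sub (hK.deriv.tendsto n)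

theorem tendsto_zero (hK : IsDecayingProfile K) : Tendsto K atTop (𝓝 0) := by
  simpa using hK.tendsto 0

theorem exists_bound (hK : IsDecayingProfile K) : ∃ C, 0 ≤ C ∧ ∀ t, |K t| ≤ C := by
  obtain ⟨T, hT⟩ := eventually_atTop.1
    ((tendsto_zero_iff_norm_tendsto_zero.1 hK.tendsto_zero).eventually (gt_mem_nhds zero_lt_one))
  obtain ⟨C, hC⟩ := (isCompact_Icc (a := (1 : ℝ)) (b := T)).exists_bound_of_continuousOn
    hK.contDiff.continuous.continuousOn
  refine ⟨max C 1, by positivity, fun t => ?_⟩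
  rcases lt_or_ge t 1 with h | h
  · rw [hK.eq_zero t h]
    simp
  rcases le_total T t with h' | h'
  · exact (hT t h').le.trans (le_max_right _ _)
  · exact (hC t ⟨h, h'⟩).trans (le_max_left _ _)

/-- Near infinity `H'` is `1/t`, all of whose derivatives decay. `H` itself is unbounded and is not
a profile: one derivative in `ζ̄` is what removes the singular factor. -/
theorem deriv_log_cutoff {H : ℝ → ℝ} (hH : ContDiff ℝ ∞ H) (h0 : ∀ t ≤ 1, H t = 0)
    (hlog : ∀ᶠ t in atTop, H t = Real.log t) : IsDecayingProfile (_root_.deriv H) where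
  contDiff := (contDiff_infty_iff_deriv.1 hH).2
  eq_zero t ht := by
    have : H =ᶠ[𝓝 t] fun _ => 0 := by
      filter_upwards [gt_mem_nhds ht] with s hs using h0 s (le_of_lt hs)
    rw [this.deriv_eq]
    simp
  tendsto n := by
    obtain ⟨T, hT⟩ := eventually_atTop.1 hlog
    have h1 : ∀ t > T, iteratedDeriv n (_root_.deriv H) t =
        (-1) ^ n * (n.factorial : ℝ) * (t ^ (n + 1))⁻¹ := by
      intro t ht
      have h2 : _root_.deriv H =ᶠ[𝓝 t] fun s : ℝ => s⁻¹ := by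
        filter_upwards [lt_mem_nhds ht] with s hs
        have : H =ᶠ[𝓝 s] Real.log := by
          filter_upwards [lt_mem_nhds hs] with r hr using hT r (le_of_lt hr)
        rw [this.deriv_eq, Real.deriv_log]
      rw [h2.iteratedDeriv_eq, iteratedDeriv_eq_iterate]
      have := iter_deriv_inv (𝕜 := ℝ) n t
      rw [this]
      congr 1
      rw [show (-1 - n : ℤ) = -((n + 1 : ℕ) : ℤ) by push_cast; ring, zpow_neg, zpow_natCast]
    have h3 : Tendsto (fun t : ℝ => (-1) ^ n * (n.factorial : ℝ) * (t ^ (n + 1))⁻¹) atTop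
        (𝓝 ((-1) ^ n * (n.factorial : ℝ) * 0)) :=
      Tendsto.const_mul _ (tendsto_inv_atTop_zero.comp (tendsto_pow_atTop (Nat.succ_ne_zero n)))
    rw [mul_zero] at h3
    refine h3.congr' ?_
    filter_upwards [eventually_gt_atTop T] with t ht using (h1 t ht).symm

end IsDecayingProfile

/-! ### Monomials in `ζ`, `ζ̄` times a function of `log |ζ|⁻²`. -/

/-- The real derivative of `ζ ↦ K (log (|ζ|² + ε)⁻¹)`. -/
theorem hasFDerivAt_comp_log_inv_sq_add {K : ℝ → ℝ} (hK : Differentiable ℝ K) {ε : ℝ} {ζ : ℂ}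
    (h : ‖ζ‖ ^ 2 + ε ≠ 0) :
    HasFDerivAt (fun ζ : ℂ => (K (Real.log ((‖ζ‖ ^ 2 + ε)⁻¹)) : ℂ))
      ((-((deriv K (Real.log ((‖ζ‖ ^ 2 + ε)⁻¹)) : ℝ) : ℂ) / ((‖ζ‖ ^ 2 + ε : ℝ) : ℂ)) •
        (conj ζ • (1 : ℂ →L[ℝ] ℂ) + ζ • (Complex.conjCLE : ℂ →L[ℝ] ℂ))) ζ := by
  have h1 : HasFDerivAt (fun ζ : ℂ => ‖ζ‖ ^ 2 + ε) (2 • innerSL ℝ ζ) ζ :=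
    ((hasStrictFDerivAt_norm_sq ζ).hasFDerivAt).add_const ε
  have h2 : HasFDerivAt (fun ζ : ℂ => Real.log ((‖ζ‖ ^ 2 + ε)⁻¹))
      (-((‖ζ‖ ^ 2 + ε)⁻¹ • (2 • innerSL ℝ ζ))) ζ := by
    simpa only [Real.log_inv] using (h1.log h).fun_neg
  have h3 := (hK (Real.log ((‖ζ‖ ^ 2 + ε)⁻¹))).hasDerivAt.comp_hasFDerivAt ζ h2
  have h4 := (Complex.ofRealCLM.hasFDerivAt).comp ζ h3
  refine h4.congr_fderiv ?_
  have hC : ((‖ζ‖ ^ 2 + ε : ℝ) : ℂ) ≠ 0 := by exact_mod_cast h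
  have key : ∀ η : ℂ, ((2 * inner ℝ ζ η : ℝ) : ℂ) = conj ζ * η + ζ * conj η := by
    intro η
    apply Complex.ext <;> simp [Complex.inner, Complex.mul_re, Complex.mul_im] <;> ring
  refine ContinuousLinearMap.ext fun η => ?_
  have := key η
  simp only [ContinuousLinearMap.comp_apply, Complex.ofRealCLM_apply,
    _root_.smul_apply, _root_.neg_apply, innerSL_apply_apply,
    _root_.add_apply, one_apply_eq_self, smul_eq_mul,
    ContinuousLinearEquiv.coe_coe, Complex.conjCLE_apply, nsmul_eq_mul]
  rw [← this]
  push_cast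
  field_simp

/-- The function `ζ ^ a * ζ̄ ^ b * K (log |ζ|⁻²)`. -/
noncomputable def logPower (a b : ℤ) (K : ℝ → ℝ) (ζ : ℂ) : ℂ :=
  ζ ^ a * conj ζ ^ b * (K (Real.log ((‖ζ‖ ^ 2)⁻¹)) : ℂ)

/-- The Wirtinger derivatives of `log |ζ|⁻²` are `-1/ζ` and `-1/ζ̄`, so differentiation lowers one
exponent by one and changes only the profile. -/
theorem hasFDerivAt_logPower (a b : ℤ) {K : ℝ → ℝ} (hK : Differentiable ℝ K) {ζ : ℂ}
    (hζ : ζ ≠ 0) :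
    HasFDerivAt (logPower a b K)
      (logPower (a - 1) b (fun t => a * K t - deriv K t) ζ • (1 : ℂ →L[ℝ] ℂ) +
        logPower a (b - 1) (fun t => b * K t - deriv K t) ζ • (Complex.conjCLE : ℂ →L[ℝ] ℂ))
      ζ := by
  have hζ' : conj ζ ≠ 0 := by simpa using hζ
  have h0 : ‖ζ‖ ^ 2 + 0 ≠ 0 := by simpa using hζ
  have h1 : HasFDerivAt (fun ζ : ℂ => ζ ^ a) _ ζ :=
    (hasDerivAt_zpow a ζ (Or.inl hζ)).hasFDerivAt.restrictScalars ℝ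
  have h2 : HasFDerivAt (fun ζ : ℂ => conj ζ ^ b) _ ζ :=
    HasFDerivAt.comp (g := fun ζ : ℂ => ζ ^ b) (f := fun ζ : ℂ => conj ζ) ζ
      ((hasDerivAt_zpow b (conj ζ) (Or.inl hζ')).hasFDerivAt.restrictScalars ℝ)
      (Complex.conjCLE : ℂ →L[ℝ] ℂ).hasFDerivAt
  have h3 := hasFDerivAt_comp_log_inv_sq_add hK h0
  simp only [add_zero] at h3
  refine ((h1.fun_mul h2).fun_mul h3).congr_fderiv ?_
  have hn : ((‖ζ‖ ^ 2 : ℝ) : ℂ) = ζ * conj ζ := by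
    rw [Complex.mul_conj, Complex.normSq_eq_norm_sq]
  rw [hn]
  refine ContinuousLinearMap.ext fun η => ?_
  simp only [ContinuousLinearMap.comp_apply, _root_.smul_apply,
    _root_.add_apply, one_apply_eq_self, smul_eq_mul,
    ContinuousLinearEquiv.coe_coe, Complex.conjCLE_apply, logPower,
    ContinuousLinearMap.coe_restrictScalars', ContinuousLinearMap.toSpanSingleton_apply]
  rw [zpow_sub_one₀ hζ, zpow_sub_one₀ hζ']
  push_cast
  field_simp
  ring

theorem norm_logPower {a b : ℤ} {n : ℕ} (h : a + b = n) (K : ℝ → ℝ) {ζ : ℂ} (hζ : ζ ≠ 0) :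
    ‖logPower a b K ζ‖ = ‖ζ‖ ^ n * |K (Real.log ((‖ζ‖ ^ 2)⁻¹))| := by
  rw [logPower, norm_mul, norm_mul, norm_zpow, norm_zpow, RCLike.norm_conj,
    ← zpow_add₀ (norm_ne_zero_iff.2 hζ), h, zpow_natCast, Complex.norm_real, Real.norm_eq_abs]

namespace IsDecayingProfile

variable {K : ℝ → ℝ} {a b : ℤ} {n : ℕ}

/-- At the origin the default values give `log(0⁻¹) = 0`, which lies in the range `t < 1` where
profiles vanish. -/
theorem logPower_zero (hK : IsDecayingProfile K) : logPower a b K 0 = 0 := by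
  simp [logPower, hK.eq_zero 0 one_pos]

theorem norm_logPower (hK : IsDecayingProfile K) (h : a + b = n) (ζ : ℂ) :
    ‖logPower a b K ζ‖ = ‖ζ‖ ^ n * |K (Real.log ((‖ζ‖ ^ 2)⁻¹))| := by
  by_cases hζ : ζ = 0
  · simp [hζ, hK.logPower_zero, hK.eq_zero 0 one_pos]
  · exact _root_.norm_logPower h K hζ

theorem tendsto_log_inv_sq : Tendsto (fun ζ : ℂ => Real.log ((‖ζ‖ ^ 2)⁻¹)) (𝓝[≠] 0) atTop := by
  refine Real.tendsto_log_atTop.comp (tendsto_inv_nhdsGT_zero.comp ?_)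
  refine tendsto_nhdsWithin_iff.2 ⟨?_, ?_⟩
  · have : Tendsto (fun ζ : ℂ => ‖ζ‖ ^ 2) (𝓝 0) (𝓝 (‖(0 : ℂ)‖ ^ 2)) :=
      Continuous.tendsto (by fun_prop) 0
    simpa using this.mono_left nhdsWithin_le_nhds
  · filter_upwards [self_mem_nhdsWithin] with ζ hζ
    have : ζ ≠ 0 := hζ
    exact mem_Ioi.2 (by positivity)

theorem tendsto_comp_log (hK : IsDecayingProfile K) :
    Tendsto (fun ζ : ℂ => K (Real.log ((‖ζ‖ ^ 2)⁻¹))) (𝓝 0) (𝓝 0) := by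
  rw [← nhdsNE_sup_pure, tendsto_sup]
  refine ⟨hK.tendsto_zero.comp tendsto_log_inv_sq, ?_⟩
  rw [tendsto_pure_left]
  intro s hs
  simpa [hK.eq_zero 0 one_pos] using mem_of_mem_nhds hs

/-- For `n = 0` the monomial is merely bounded near the origin, and continuity there comes from `K →
0`. -/
theorem continuous_logPower (hK : IsDecayingProfile K) (h : a + b = n) :
    Continuous (logPower a b K) := by
  refine continuous_iff_continuousAt.2 fun ζ => ?_
  by_cases hζ : ζ = 0
  · rw [hζ, ContinuousAt, hK.logPower_zero, tendsto_zero_iff_norm_tendsto_zero]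
    simp_rw [hK.norm_logPower h]
    have h1 : Tendsto (fun ζ : ℂ => ‖ζ‖ ^ n * |K (Real.log ((‖ζ‖ ^ 2)⁻¹))|) (𝓝 0)
        (𝓝 (‖(0 : ℂ)‖ ^ n * |0|)) :=
      (Continuous.tendsto (by fun_prop) 0).mul hK.tendsto_comp_log.abs
    simpa using h1
  · exact (hasFDerivAt_logPower a b (hK.contDiff.differentiable (by simp)) hζ).continuousAt

theorem hasFDerivAt_logPower (hK : IsDecayingProfile K) (h : a + b = (n + 1 : ℕ)) (ζ : ℂ) :
    HasFDerivAt (logPower a b K)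
      (logPower (a - 1) b (fun t => a * K t - _root_.deriv K t) ζ • (1 : ℂ →L[ℝ] ℂ) +
        logPower a (b - 1) (fun t => b * K t - _root_.deriv K t) ζ •
          (Complex.conjCLE : ℂ →L[ℝ] ℂ)) ζ := by
  by_cases hζ : ζ = 0
  · rw [hζ, (hK.const_mul_sub_deriv a).logPower_zero, (hK.const_mul_sub_deriv b).logPower_zero]
    refine HasFDerivAt.of_isLittleO ?_
    simp only [hK.logPower_zero, sub_zero]
    have h1 : (fun ζ : ℂ => ‖ζ‖ * (‖ζ‖ ^ n * |K (Real.log ((‖ζ‖ ^ 2)⁻¹))|)) =o[𝓝 0]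
        fun ζ : ℂ => ‖ζ‖ * 1 := by
      refine (Asymptotics.isBigO_refl _ _).mul_isLittleO ((Asymptotics.isLittleO_one_iff ℝ).2 ?_)
      have h2 : Tendsto (fun ζ : ℂ => ‖ζ‖ ^ n * |K (Real.log ((‖ζ‖ ^ 2)⁻¹))|) (𝓝 0)
          (𝓝 (‖(0 : ℂ)‖ ^ n * |0|)) :=
        (Continuous.tendsto (by fun_prop) 0).mul hK.tendsto_comp_log.abs
      simpa using h2
    simp only [mul_one] at h1
    refine (Asymptotics.isLittleO_norm_norm.1 ?_)
    refine (h1.congr_left fun ζ => ?_)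
    calc _ = ‖logPower a b K ζ‖ := by rw [hK.norm_logPower h, pow_succ]; ring
      _ = ‖logPower a b K ζ - (0 * ζ + 0 * conj ζ)‖ := by simp
  · exact _root_.hasFDerivAt_logPower a b (hK.contDiff.differentiable (by simp)) hζ

theorem contDiff_logPower (hK : IsDecayingProfile K) (h : a + b = n) :
    ContDiff ℝ n (logPower a b K) := by
  induction n generalizing a b K with
  | zero => exact contDiff_zero.2 (hK.continuous_logPower h)
  | succ n ih =>
    push_cast
    refine contDiff_succ_iff_hasFDerivAt.2 ⟨_, ?_, hK.hasFDerivAt_logPower h⟩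
    push_cast at h
    exact ((ih (hK.const_mul_sub_deriv a) (by linarith)).smul contDiff_const).add
      ((ih (hK.const_mul_sub_deriv b) (by linarith)).smul contDiff_const)

/-- Each derivative lowers the total degree `a + b` by one and leaves a bounded profile, so the
homogeneous bounds hold on the whole plane. -/
theorem exists_norm_iteratedFDeriv_logPower_le (hK : IsDecayingProfile K) (h : a + b = n) {k : ℕ}
    (hk : k ≤ n) : ∃ C, 0 ≤ C ∧
      ∀ ζ, ‖iteratedFDeriv ℝ k (logPower a b K) ζ‖ ≤ C * ‖ζ‖ ^ (n - k) := by
  induction k generalizing a b K n with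
  | zero =>
    obtain ⟨C, hC0, hC⟩ := hK.exists_bound
    refine ⟨C, hC0, fun ζ => ?_⟩
    rw [norm_iteratedFDeriv_zero, hK.norm_logPower h, mul_comm, Nat.sub_zero]
    gcongr
    exact hC _
  | succ k ih =>
    obtain ⟨m, rfl⟩ : ∃ m, n = m + 1 := ⟨n - 1, by omega⟩
    have h1 : a - 1 + b = (m : ℤ) := by push_cast at h; linarith
    have h2 : a + (b - 1) = (m : ℤ) := by push_cast at h; linarith
    have hK1 := hK.const_mul_sub_deriv a
    have hK2 := hK.const_mul_sub_deriv b
    obtain ⟨C₁, hC₁0, hC₁⟩ := ih hK1 h1 (by omega)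
    obtain ⟨C₂, hC₂0, hC₂⟩ := ih hK2 h2 (by omega)
    let L₁ : ℂ →L[ℝ] (ℂ →L[ℝ] ℂ) :=
      (ContinuousLinearMap.lsmul ℝ ℂ (E := ℂ →L[ℝ] ℂ)).flip 1
    let L₂ : ℂ →L[ℝ] (ℂ →L[ℝ] ℂ) :=
      (ContinuousLinearMap.lsmul ℝ ℂ (E := ℂ →L[ℝ] ℂ)).flip (Complex.conjCLE : ℂ →L[ℝ] ℂ)
    have hf : fderiv ℝ (logPower a b K) =
        (L₁ ∘ logPower (a - 1) b (fun t => a * K t - _root_.deriv K t)) +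
          (L₂ ∘ logPower a (b - 1) (fun t => b * K t - _root_.deriv K t)) := by
      ext1 ζ
      exact (hK.hasFDerivAt_logPower h ζ).fderiv
    have hd1 : ContDiff ℝ k (logPower (a - 1) b (fun t => a * K t - _root_.deriv K t)) :=
      (hK1.contDiff_logPower h1).of_le (by exact_mod_cast (by omega : k ≤ m))
    have hd2 : ContDiff ℝ k (logPower a (b - 1) (fun t => b * K t - _root_.deriv K t)) :=
      (hK2.contDiff_logPower h2).of_le (by exact_mod_cast (by omega : k ≤ m))
    refine ⟨‖L₁‖ * C₁ + ‖L₂‖ * C₂, by positivity, fun ζ => ?_⟩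
    rw [← norm_iteratedFDeriv_fderiv, hf, iteratedFDeriv_add_apply (L₁.contDiff.comp hd1).contDiffAt
      (L₂.contDiff.comp hd2).contDiffAt, Nat.add_sub_add_right]
    refine (norm_add_le _ _).trans ?_
    rw [add_mul, mul_assoc, mul_assoc]
    refine add_le_add ?_ ?_
    · exact (L₁.norm_iteratedFDeriv_comp_left hd1.contDiffAt le_rfl).trans (by gcongr; exact hC₁ ζ)
    · exact (L₂.norm_iteratedFDeriv_comp_left hd2.contDiffAt le_rfl).trans (by gcongr; exact hC₂ ζ)

end IsDecayingProfile

/-! ### Smoothness of series of functions of homogeneous growth. -/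

theorem norm_iteratedFDeriv_snd_le {E E' : Type*} [NormedAddCommGroup E] [NormedSpace ℝ E]
    [NormedAddCommGroup E'] [NormedSpace ℝ E'] (j : ℕ) (q : E × E') :
    ‖iteratedFDeriv ℝ j (fun q : E × E' => q.2) q‖ ≤
      if j = 0 then ‖q‖ else if j = 1 then 1 else 0 := by
  rcases j with _ | _ | j
  · simpa using norm_snd_le q
  · rw [← norm_iteratedFDeriv_fderiv, norm_iteratedFDeriv_zero, fderiv_snd]
    simpa using ContinuousLinearMap.norm_snd_le ℝ E E'
  · have h : fderiv ℝ (fun q : E × E' => q.2) = fun _ => ContinuousLinearMap.snd ℝ E E' := by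
      ext1 x
      exact fderiv_snd
    rw [← norm_iteratedFDeriv_fderiv, h, iteratedFDeriv_const_of_ne (by omega)]
    simp

/-- Homogeneous growth of order `n` of the derivatives of `f` gives homogeneous growth of order
`n + 1` of the derivatives of `(x, y) ↦ f x y`. -/
theorem exists_norm_iteratedFDeriv_apply_snd_le {E E' F : Type*} [NormedAddCommGroup E]
    [NormedSpace ℝ E] [NormedAddCommGroup E'] [NormedSpace ℝ E'] [NormedAddCommGroup F]
    [NormedSpace ℝ F] {f : E → E' →L[ℝ] F} {m n : ℕ} (hmn : m ≤ n) (hf : ContDiff ℝ m f)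
    (hb : ∀ k ≤ m, ∃ C, 0 ≤ C ∧ ∀ x, ‖iteratedFDeriv ℝ k f x‖ ≤ C * ‖x‖ ^ (n - k)) {k : ℕ}
    (hk : k ≤ m) :
    ∃ C, 0 ≤ C ∧ ∀ q : E × E',
      ‖iteratedFDeriv ℝ k (fun q : E × E' => f q.1 q.2) q‖ ≤ C * ‖q‖ ^ (n + 1 - k) := by
  choose! C hC0 hC using hb
  refine ⟨∑ i ∈ Finset.range (k + 1), (k.choose i : ℝ) * C i,
    Finset.sum_nonneg fun i hi => mul_nonneg (by positivity)
      (hC0 i (by have := Finset.mem_range.1 hi; omega)), fun q => ?_⟩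
  have h1 : ContDiff ℝ m fun q : E × E' => f q.1 := hf.comp contDiff_fst
  refine (norm_iteratedFDeriv_clm_apply (N := m) h1 contDiff_snd q (by exact_mod_cast hk)).trans ?_
  rw [Finset.sum_mul]
  refine Finset.sum_le_sum fun i hi => ?_
  have hi' : i ≤ k := by have := Finset.mem_range.1 hi; omega
  have hfst : ‖iteratedFDeriv ℝ i (fun q : E × E' => f q.1) q‖ ≤ C i * ‖q‖ ^ (n - i) := by
    have h2 := (ContinuousLinearMap.fst ℝ E E').iteratedFDeriv_comp_right hf q (i := i)
      (by exact_mod_cast hi'.trans hk)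
    have h3 : (fun q : E × E' => f q.1) = f ∘ (ContinuousLinearMap.fst ℝ E E') := rfl
    rw [h3, h2]
    refine (ContinuousMultilinearMap.norm_compContinuousLinearMap_le _ _).trans ?_
    calc _ ≤ C i * ‖q.1‖ ^ (n - i) * 1 := by
          refine mul_le_mul (hC i (hi'.trans hk) _) ?_ (by positivity)
            (mul_nonneg (hC0 i (hi'.trans hk)) (by positivity))
          exact Finset.prod_le_one (fun _ _ => norm_nonneg _)
            fun _ _ => ContinuousLinearMap.norm_fst_le ℝ E E'
      _ ≤ _ := by
          rw [mul_one]
          have := hC0 i (hi'.trans hk)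
          gcongr
          exact norm_fst_le q
  have hsnd := norm_iteratedFDeriv_snd_le (k - i) q
  have hCi := hC0 i (hi'.trans hk)
  rw [mul_assoc, mul_assoc]
  refine mul_le_mul_of_nonneg_left ?_ (by positivity)
  refine (mul_le_mul hfst hsnd (norm_nonneg _) (by positivity)).trans ?_
  rw [mul_assoc]
  refine mul_le_mul_of_nonneg_left ?_ hCi
  -- The second factor is linear, so only the Leibniz terms `i = k` and `i = k - 1` survive; both
  -- carry the power `n + 1 - k`.
  split_ifs with h h'
  · rw [← pow_succ]
    exact le_of_eq (congrArg _ (by omega))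
  · rw [mul_one]
    exact le_of_eq (congrArg _ (by omega))
  · rw [mul_zero]
    positivity

section SeriesClassC

variable {p : ℕ} {V E : Type*} [NormedAddCommGroup V] [NormedSpace ℝ V] [NormedAddCommGroup E]
  [NormedSpace ℝ E]

/-- A sequence of continuous linear maps `π ν` with `∑ ‖π ν v‖ ^ p ≤ A ‖v‖ ^ p`. -/
structure IsPowerSummable (p : ℕ) (π : ℕ → V →L[ℝ] E) (A : ℝ) : Prop where
  nonneg : 0 ≤ A
  summable : ∀ v, Summable fun ν => ‖π ν v‖ ^ p
  tsum_le : ∀ v, ∑' ν, ‖π ν v‖ ^ p ≤ A * ‖v‖ ^ p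

theorem norm_add_pow_le {F : Type*} [SeminormedAddCommGroup F] (p : ℕ) (x y : F) :
    ‖x + y‖ ^ p ≤ 2 ^ (p - 1) * (‖x‖ ^ p + ‖y‖ ^ p) :=
  (pow_le_pow_left₀ (norm_nonneg _) (norm_add_le x y) p).trans
    (add_pow_le (norm_nonneg _) (norm_nonneg _) p)

variable {π : ℕ → V →L[ℝ] E} {A : ℝ}

/-- The differential of a function on `V` lives on `V × V`, so each order of smoothness doubles the
space. The constant doubles because the `p`-th power of a maximum is at most the sum of the `p`-th
powers. -/
theorem IsPowerSummable.prodMap (hπ : IsPowerSummable p π A) :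
    IsPowerSummable p (fun ν => (π ν).prodMap (π ν)) (A + A) := by
  have hle : ∀ (v : V × V) (ν : ℕ),
      ‖((π ν).prodMap (π ν)) v‖ ^ p ≤ ‖π ν v.1‖ ^ p + ‖π ν v.2‖ ^ p := by
    intro v ν
    have h1 : 0 ≤ ‖π ν v.1‖ ^ p := by positivity
    have h2 : 0 ≤ ‖π ν v.2‖ ^ p := by positivity
    rw [ContinuousLinearMap.coe_prodMap', Prod.norm_def]
    rcases max_choice ‖(Prod.map (π ν) (π ν) v).1‖ ‖(Prod.map (π ν) (π ν) v).2‖ with h | h <;>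
      rw [h] <;> simp only [Prod.map_fst, Prod.map_snd] <;> linarith
  have hs : ∀ v : V × V, Summable fun ν => ‖((π ν).prodMap (π ν)) v‖ ^ p := fun v =>
    Summable.of_nonneg_of_le (fun ν => by positivity) (hle v)
      ((hπ.summable v.1).add (hπ.summable v.2))
  refine ⟨add_nonneg hπ.nonneg hπ.nonneg, hs, fun v => ?_⟩
  refine ((hs v).tsum_le_tsum (hle v) ((hπ.summable v.1).add (hπ.summable v.2))).trans ?_
  rw [(hπ.summable v.1).tsum_add (hπ.summable v.2), add_mul]
  have hA := hπ.nonneg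
  refine add_le_add ((hπ.tsum_le _).trans ?_) ((hπ.tsum_le _).trans ?_)
  · gcongr
    exact norm_fst_le v
  · gcongr
    exact norm_snd_le v

/-- The series need not converge uniformly on a ball. Near `v₀`, however, convexity of `t^p` bounds
the tail at `v` by the tail at `v₀`, which is small, plus a multiple of `‖v - v₀‖^p`. -/
theorem IsPowerSummable.continuous_tsum (hπ : IsPowerSummable p π A) (hp : 1 ≤ p) {G : E → ℂ}
    (hG : Continuous G) {C : ℝ} (hC : 0 ≤ C) (hGC : ∀ x, ‖G x‖ ≤ C * ‖x‖ ^ p) :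
    Continuous fun v => ∑' ν, G (π ν v) := by
  have hsum : ∀ v, Summable fun ν => G (π ν v) := fun v =>
    Summable.of_norm_bounded ((hπ.summable v).mul_left C) fun ν => hGC _
  refine continuous_iff_continuousAt.2 fun v₀ => ?_
  refine continuousAt_of_locally_uniform_approx_of_continuousAt fun u hu => ?_
  obtain ⟨ε, hε, hεu⟩ := Metric.mem_uniformity_dist.1 hu
  have h1 : Tendsto (fun s : Finset ℕ => C * (2 ^ (p - 1) * ∑' ν : {ν // ν ∉ s}, ‖π ν v₀‖ ^ p))
      atTop (𝓝 (C * (2 ^ (p - 1) * 0))) :=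
    ((tendsto_tsum_compl_atTop_zero fun ν => ‖π ν v₀‖ ^ p).const_mul _).const_mul _
  rw [mul_zero, mul_zero] at h1
  obtain ⟨s, hs⟩ := (h1.eventually (gt_mem_nhds (half_pos hε))).exists
  have h2 : Tendsto (fun v => C * (2 ^ (p - 1) * (A * ‖v - v₀‖ ^ p))) (𝓝 v₀)
      (𝓝 (C * (2 ^ (p - 1) * (A * ‖v₀ - v₀‖ ^ p)))) := Continuous.tendsto (by fun_prop) _
  rw [sub_self, norm_zero, zero_pow (by omega), mul_zero, mul_zero, mul_zero] at h2
  refine ⟨_, h2.eventually (gt_mem_nhds (half_pos hε)), fun v => ∑ ν ∈ s, G (π ν v),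
    (continuous_finsetSum _ fun ν _ => hG.comp (π ν).continuous).continuousAt, fun v hv => hεu ?_⟩
  simp only [Set.mem_ofPred_eq] at hv
  rw [dist_eq_norm, ← (hsum v).sum_add_tsum_subtype_compl s, add_sub_cancel_left]
  have hsub : ∀ w, Summable fun ν : {ν // ν ∉ s} => ‖π ν w‖ ^ p := fun w =>
    (hπ.summable w).subtype _
  calc ‖∑' ν : {ν // ν ∉ s}, G (π ν v)‖
      ≤ ∑' ν : {ν // ν ∉ s}, C * (2 ^ (p - 1) * (‖π ν v₀‖ ^ p + ‖π ν (v - v₀)‖ ^ p)) := by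
        refine tsum_of_norm_bounded
          ((((hsub v₀).add (hsub (v - v₀))).mul_left _).mul_left _).hasSum fun ν => ?_
        refine (hGC _).trans ?_
        gcongr
        have := norm_add_pow_le p (π ν v₀) (π ν (v - v₀))
        rwa [← map_add, add_sub_cancel] at this
    _ = C * (2 ^ (p - 1) * ∑' ν : {ν // ν ∉ s}, ‖π ν v₀‖ ^ p) +
          C * (2 ^ (p - 1) * ∑' ν : {ν // ν ∉ s}, ‖π ν (v - v₀)‖ ^ p) := by
        rw [tsum_mul_left, tsum_mul_left, (hsub v₀).tsum_add (hsub (v - v₀))]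
        ring
    _ ≤ C * (2 ^ (p - 1) * ∑' ν : {ν // ν ∉ s}, ‖π ν v₀‖ ^ p) +
          C * (2 ^ (p - 1) * (A * ‖v - v₀‖ ^ p)) := by
        gcongr
        refine le_trans ?_ (hπ.tsum_le (v - v₀))
        exact (hπ.summable (v - v₀)).tsum_subtype_le _ _ fun ν => by positivity
    _ < ε := by linarith

theorem IsPowerSummable.hasLineDerivAt_tsum (hπ : IsPowerSummable p π A) (hp : 1 ≤ p) {G : E → ℂ}
    (hG : ContDiff ℝ 1 G) {C : ℝ} (hGC : ∀ x, ‖G x‖ ≤ C * ‖x‖ ^ p) {C' : ℝ}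
    (hC' : 0 ≤ C') (hGC' : ∀ x, ‖fderiv ℝ G x‖ ≤ C' * ‖x‖ ^ (p - 1)) (v w : V) :
    HasLineDerivAt ℝ (fun v => ∑' ν, G (π ν v)) (∑' ν, fderiv ℝ G (π ν v) (π ν w)) v w := by
  have hd : ∀ ν (t : ℝ), HasDerivAt (fun t : ℝ => G (π ν (v + t • w)))
      (fderiv ℝ G (π ν (v + t • w)) (π ν w)) t := by
    intro ν t
    have h1 : HasDerivAt (fun t : ℝ => π ν (v + t • w)) (π ν w) t := by
      have h2 : HasDerivAt (fun t : ℝ => v + t • w) w t := by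
        simpa using ((hasDerivAt_id t).smul_const w).const_add v
      exact (π ν).hasFDerivAt.comp_hasDerivAt t h2
    exact (hG.differentiable one_ne_zero _).hasFDerivAt.comp_hasDerivAt t h1
  have hb : ∀ ν (t : ℝ), t ∈ Metric.ball (0 : ℝ) 1 →
      ‖fderiv ℝ G (π ν (v + t • w)) (π ν w)‖ ≤
        C' * (2 ^ (p - 1) * (‖π ν v‖ ^ p + ‖π ν w‖ ^ p)) := by
    intro ν t ht
    have ht' : ‖t‖ ≤ 1 := by simpa using (mem_ball_zero_iff.1 ht).le
    have h1 : ‖π ν (v + t • w)‖ ≤ ‖π ν v‖ + ‖π ν w‖ := by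
      rw [map_add, map_smul]
      refine (norm_add_le _ _).trans ?_
      gcongr
      rw [norm_smul]
      exact mul_le_of_le_one_left (norm_nonneg _) ht'
    calc _ ≤ ‖fderiv ℝ G (π ν (v + t • w))‖ * ‖π ν w‖ := ContinuousLinearMap.le_opNorm _ _
      _ ≤ C' * (‖π ν v‖ + ‖π ν w‖) ^ (p - 1) * (‖π ν v‖ + ‖π ν w‖) := by
          refine mul_le_mul ((hGC' _).trans ?_) (le_add_of_nonneg_left (norm_nonneg _))
            (norm_nonneg _) (by positivity)
          gcongr
      _ = C' * (‖π ν v‖ + ‖π ν w‖) ^ p := by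
          rw [mul_assoc, ← pow_succ, Nat.sub_add_cancel hp]
      _ ≤ _ := by
          gcongr
          exact add_pow_le (norm_nonneg _) (norm_nonneg _) p
  have h := hasDerivAt_tsum_of_isPreconnected
    ((((hπ.summable v).add (hπ.summable w)).mul_left _).mul_left C') Metric.isOpen_ball
    (convex_ball (0 : ℝ) 1).isPreconnected (fun ν t _ => hd ν t) hb
    (Metric.mem_ball_self one_pos)
    (by simpa using Summable.of_norm_bounded ((hπ.summable v).mul_left C) fun ν => hGC _)
    (Metric.mem_ball_self one_pos)
  simpa [HasLineDerivAt] using h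

end SeriesClassC

/-- The differential of `∑ G(π_ν v)` is a series of the same kind, with `DG(x) y` in place of `G`
and `π_ν × π_ν` in place of `π_ν`. Differentiation lowers the growth order to `p - 1` and pairing
with `y` restores it to `p`, so the induction costs one derivative and nothing else. -/
theorem IsPowerSummable.isClassC.{u} {p : ℕ} (hp : 1 ≤ p) (m : ℕ) : ∀ {V : Type u} {E : Type}
    [NormedAddCommGroup V] [NormedSpace ℝ V] [NormedAddCommGroup E] [NormedSpace ℝ E]
    {π : ℕ → V →L[ℝ] E} {A : ℝ} (_ : IsPowerSummable p π A) (_ : m ≤ p) {G : E → ℂ}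
    (_ : ContDiff ℝ m G)
    (_ : ∀ k ≤ m, ∃ C, 0 ≤ C ∧ ∀ x, ‖iteratedFDeriv ℝ k G x‖ ≤ C * ‖x‖ ^ (p - k)),
    IsClassC m univ fun v => ∑' ν, G (π ν v) := by
  induction m with
  | zero =>
    intro V E _ _ _ _ π A hπ _ G hG hb
    obtain ⟨C, hC0, hC⟩ := hb 0 le_rfl
    exact (hπ.continuous_tsum hp hG.continuous hC0 (by simpa using hC)).continuousOn
  | succ m ih =>
    intro V E _ _ _ _ π A hπ hm G hG hb
    obtain ⟨C, hC0, hC⟩ := hb 0 (by omega)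
    obtain ⟨C', hC0', hC'⟩ := hb 1 (by omega)
    simp only [norm_iteratedFDeriv_zero, Nat.sub_zero] at hC
    simp only [← norm_iteratedFDeriv_fderiv, norm_iteratedFDeriv_zero] at hC'
    have hd := fun v w => hπ.hasLineDerivAt_tsum hp (hG.of_le (by simp)) hC hC0' hC' v w
    refine ⟨fun v _ w => (hd v w).lineDifferentiableAt, ?_⟩
    have h1 : (fun q : V × V => lineDeriv ℝ (fun v => ∑' ν, G (π ν v)) q.1 q.2) =
        fun q => ∑' ν, (fun x : E × E => fderiv ℝ G x.1 x.2) ((π ν).prodMap (π ν) q) := by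
      ext q
      exact (hd q.1 q.2).lineDeriv
    rw [h1, univ_prod_univ]
    have hG' : ContDiff ℝ m (fderiv ℝ G) := hG.fderiv_right (by norm_cast)
    obtain ⟨n, rfl⟩ : ∃ n, p = n + 1 := ⟨p - 1, by omega⟩
    refine ih hπ.prodMap (by omega) ((hG'.comp contDiff_fst).clm_apply contDiff_snd)
      fun k hk => exists_norm_iteratedFDeriv_apply_snd_le (by omega) hG' (fun k hk => ?_) hk
    obtain ⟨D, hD0, hD⟩ := hb (k + 1) (by omega)
    refine ⟨D, hD0, fun x => ?_⟩
    rw [norm_iteratedFDeriv_fderiv]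
    simpa using hD x

/-! ### The potential, its `∂̄`-derivative and the weak equation between them. -/

/-- Smooth functions on the line that vanish on `(-∞, 1]`, agree with the logarithm near `+∞` and
are `1`-Lipschitz. -/
structure IsLogCutoff (H : ℝ → ℝ) : Prop where
  contDiff : ContDiff ℝ ∞ H
  eq_zero : ∀ t ≤ 1, H t = 0
  eventually_eq_log : ∀ᶠ t in atTop, H t = Real.log t
  abs_deriv_le : ∀ t, |deriv H t| ≤ 1

/-- The function `ζ ^ p * H (log (|ζ|² + ε)⁻¹)`. -/
noncomputable def powMulLog (p : ℕ) (H : ℝ → ℝ) (ε : ℝ) (ζ : ℂ) : ℂ :=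
  ζ ^ p * (H (Real.log ((‖ζ‖ ^ 2 + ε)⁻¹)) : ℂ)

/-- The derivative of `powMulLog p H ε` with respect to `ζ̄`. -/
noncomputable def powMulLogDbar (p : ℕ) (H : ℝ → ℝ) (ε : ℝ) (ζ : ℂ) : ℂ :=
  -(ζ ^ (p + 1) * ((deriv H (Real.log ((‖ζ‖ ^ 2 + ε)⁻¹)) / (‖ζ‖ ^ 2 + ε) : ℝ) : ℂ))

section Dbar

variable {V : Type*} [NormedAddCommGroup V] [NormedSpace ℂ V]

theorem dbar_comp_of_hasFDerivAt {g : ℂ → ℂ} (ℓ : V →L[ℂ] ℂ) {z : V} {A B : ℂ}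
    (h : HasFDerivAt g (A • (1 : ℂ →L[ℝ] ℂ) + B • (Complex.conjCLE : ℂ →L[ℝ] ℂ)) (ℓ z)) (v : V) :
    dbar (fun z => g (ℓ z)) z v = B * conj (ℓ v) := by
  have h1 : HasFDerivAt (fun z => g (ℓ z)) _ z :=
    h.comp z (ℓ.restrictScalars ℝ).hasFDerivAt
  have h2 : ∀ v, fderiv ℝ (fun z => g (ℓ z)) z v = A * ℓ v + B * conj (ℓ v) := fun v => by
    rw [h1.fderiv]
    rfl
  rw [dbar, h2, h2, map_smul, smul_eq_mul, map_mul, Complex.conj_I]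
  linear_combination (A * ℓ v - B * conj (ℓ v)) / 2 * Complex.I_sq

theorem dbar_eq_of_hasFDerivAt {g : ℂ → ℂ} {z : ℂ} {A B : ℂ}
    (h : HasFDerivAt g (A • (1 : ℂ →L[ℝ] ℂ) + B • (Complex.conjCLE : ℂ →L[ℝ] ℂ)) z) :
    dbar g z 1 = B := by
  simpa using dbar_comp_of_hasFDerivAt (ContinuousLinearMap.id ℂ ℂ) h 1

theorem ContDiff.continuous_dbar {g : V → ℂ} (hg : ContDiff ℝ 1 g) (v : V) :
    Continuous fun z => dbar g z v := by
  have h := hg.continuous_fderiv one_ne_zero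
  unfold dbar
  fun_prop

theorem HasCompactSupport.dbar {g : V → ℂ} (hg : HasCompactSupport g) (v : V) :
    HasCompactSupport fun z => dbar g z v := by
  refine HasCompactSupport.intro hg fun z hz => ?_
  have : fderiv ℝ g z = 0 := by
    by_contra h
    exact hz (tsupport_fderiv_subset ℝ (subset_tsupport _ h))
  simp [_root_.dbar, this]

theorem integral_mul_dbar_eq_neg [FiniteDimensional ℝ V] [MeasurableSpace V] [BorelSpace V]
    (μ : Measure V) [μ.IsAddHaarMeasure] {F g : V → ℂ} (hF : ContDiff ℝ 1 F)
    (hg : ContDiff ℝ 1 g) (hgc : HasCompactSupport g) (v : V) :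
    ∫ z, F z * dbar g z v ∂μ = -∫ z, dbar F z v * g z ∂μ := by
  have hFc := hF.continuous
  have hF' := hF.continuous_fderiv one_ne_zero
  have hg' := hg.continuous_fderiv one_ne_zero
  have i1 : ∀ v, Integrable (fun z => F z * fderiv ℝ g z v) μ := fun v =>
    Continuous.integrable_of_hasCompactSupport (by fun_prop)
      (HasCompactSupport.mul_left (hgc.fderiv_apply ℝ v))
  have i2 : ∀ v, Integrable (fun z => fderiv ℝ F z v * g z) μ := fun v =>
    Continuous.integrable_of_hasCompactSupport (by have := hg.continuous; fun_prop) hgc.mul_left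
  have i3 : Integrable (fun z => F z * g z) μ :=
    Continuous.integrable_of_hasCompactSupport (hFc.mul hg.continuous) hgc.mul_left
  have key : ∀ v, ∫ z, F z * fderiv ℝ g z v ∂μ = -∫ z, fderiv ℝ F z v * g z ∂μ := fun v =>
    integral_mul_fderiv_eq_neg_fderiv_mul_of_integrable (i2 v) (i1 v) i3
      (fun _ _ => hF.differentiable one_ne_zero _) (fun _ _ => hg.differentiable one_ne_zero _)
  have e1 : ∀ z, F z * dbar g z v = (1 / 2) * (F z * fderiv ℝ g z v) +
      (1 / 2 * Complex.I) * (F z * fderiv ℝ g z (Complex.I • v)) := fun z => by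
    rw [dbar]; ring
  have e2 : ∀ z, dbar F z v * g z = (1 / 2) * (fderiv ℝ F z v * g z) +
      (1 / 2 * Complex.I) * (fderiv ℝ F z (Complex.I • v) * g z) := fun z => by
    rw [dbar]; ring
  simp_rw [e1, e2]
  rw [integral_add ((i1 _).const_mul _) ((i1 _).const_mul _),
    integral_add ((i2 _).const_mul _) ((i2 _).const_mul _), integral_const_mul, integral_const_mul,
    integral_const_mul, integral_const_mul, key, key]
  ring

end Dbar

theorem hasFDerivAt_powMulLog {p : ℕ} {H : ℝ → ℝ} (hH : Differentiable ℝ H) {ε : ℝ} {ζ : ℂ}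
    (h : ‖ζ‖ ^ 2 + ε ≠ 0) : ∃ A : ℂ, HasFDerivAt (powMulLog p H ε)
      (A • (1 : ℂ →L[ℝ] ℂ) + powMulLogDbar p H ε ζ • (Complex.conjCLE : ℂ →L[ℝ] ℂ)) ζ := by
  have h1 : HasFDerivAt (fun ζ : ℂ => ζ ^ p) _ ζ :=
    (hasDerivAt_pow p ζ).hasFDerivAt.restrictScalars ℝ
  have h2 := h1.fun_mul (hasFDerivAt_comp_log_inv_sq_add hH h)
  refine ⟨p * ζ ^ (p - 1) * (H (Real.log ((‖ζ‖ ^ 2 + ε)⁻¹)) : ℂ) - ζ ^ p * conj ζ *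
    ((deriv H (Real.log ((‖ζ‖ ^ 2 + ε)⁻¹)) / (‖ζ‖ ^ 2 + ε) : ℝ) : ℂ), h2.congr_fderiv ?_⟩
  have hC : ((‖ζ‖ ^ 2 + ε : ℝ) : ℂ) ≠ 0 := by exact_mod_cast h
  refine ContinuousLinearMap.ext fun η => ?_
  simp only [_root_.smul_apply, _root_.add_apply, one_apply_eq_self, smul_eq_mul,
    ContinuousLinearEquiv.coe_coe, Complex.conjCLE_apply, powMulLogDbar,
    ContinuousLinearMap.coe_restrictScalars', ContinuousLinearMap.toSpanSingleton_apply]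
  push_cast
  push_cast at hC
  field_simp
  ring

namespace IsLogCutoff

variable {H : ℝ → ℝ} {p : ℕ} {ε : ℝ}

theorem differentiable (hH : IsLogCutoff H) : Differentiable ℝ H :=
  hH.contDiff.differentiable (by simp)

theorem abs_le (hH : IsLogCutoff H) (t : ℝ) : |H t| ≤ |t| := by
  have := Convex.norm_image_sub_le_of_norm_deriv_le (f := H) (s := univ) (x := 0) (y := t)
    (fun x _ => hH.differentiable x) (fun x _ => hH.abs_deriv_le x) convex_univ trivial trivial
  simpa [hH.eq_zero 0 zero_le_one] using this

/-- The bound is uniform in `ε`: increasing `ε` decreases the logarithm, and `H` vanishes wherever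
its argument is at most one. The majorant is continuous because `t log t` is, which makes it usable
in dominated convergence. -/
theorem norm_powMulLog_le (hH : IsLogCutoff H) (hp : 1 ≤ p) (hε : 0 ≤ ε) (ζ : ℂ) :
    ‖powMulLog p H ε ζ‖ ≤ ‖ζ‖ ^ (p - 1) * (2 * |‖ζ‖ * Real.log ‖ζ‖|) := by
  by_cases hζ : ζ = 0
  · simp [hζ, powMulLog, zero_pow (show p ≠ 0 by omega)]
  have h0 : 0 < ‖ζ‖ := norm_pos_iff.2 hζ
  have h1 : |H (Real.log ((‖ζ‖ ^ 2 + ε)⁻¹))| ≤ 2 * |Real.log ‖ζ‖| := by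
    rcases le_total (Real.log ((‖ζ‖ ^ 2 + ε)⁻¹)) 1 with h | h
    · rw [hH.eq_zero _ h, abs_zero]
      positivity
    · refine (hH.abs_le _).trans ?_
      rw [abs_of_nonneg (by linarith)]
      calc Real.log ((‖ζ‖ ^ 2 + ε)⁻¹) ≤ Real.log ((‖ζ‖ ^ 2)⁻¹) := by
            refine Real.log_le_log (by positivity) (inv_anti₀ (by positivity) (by linarith))
        _ = 2 * (-Real.log ‖ζ‖) := by rw [Real.log_inv, Real.log_pow]; push_cast; ring
        _ ≤ _ := by gcongr; exact neg_le_abs _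
  rw [powMulLog, norm_mul, norm_pow, Complex.norm_real, Real.norm_eq_abs, abs_mul, abs_of_pos h0]
  calc _ ≤ ‖ζ‖ ^ p * (2 * |Real.log ‖ζ‖|) := by gcongr
    _ = _ := by
      conv_lhs => rw [← Nat.sub_add_cancel hp, pow_succ]
      ring

/-- The slope bound `|H'| ≤ 1` gives constant exactly one here, and hence in the growth bound for
the form. -/
theorem norm_powMulLogDbar_le (hH : IsLogCutoff H) (hp : 1 ≤ p) (hε : 0 ≤ ε) (ζ : ℂ) :
    ‖powMulLogDbar p H ε ζ‖ ≤ ‖ζ‖ ^ (p - 1) := by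
  by_cases hζ : ζ = 0
  · simp [hζ, powMulLogDbar]
  have h0 : 0 < ‖ζ‖ := norm_pos_iff.2 hζ
  rw [powMulLogDbar, norm_neg, norm_mul, norm_pow, Complex.norm_real, Real.norm_eq_abs, abs_div,
    abs_of_pos (by positivity : 0 < ‖ζ‖ ^ 2 + ε), mul_div_assoc', div_le_iff₀ (by positivity)]
  calc _ ≤ ‖ζ‖ ^ (p + 1) * 1 := by gcongr; exact hH.abs_deriv_le _
    _ = ‖ζ‖ ^ (p - 1) * ‖ζ‖ ^ 2 := by rw [← pow_add, mul_one]; congr 1; omega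
    _ ≤ _ := by gcongr; linarith

theorem contDiffAt_powMulLog (hH : IsLogCutoff H) {ζ : ℂ} (h : ‖ζ‖ ^ 2 + ε ≠ 0) :
    ContDiffAt ℝ ∞ (powMulLog p H ε) ζ := by
  have h1 : ContDiffAt ℝ ∞ (fun ζ : ℂ => Real.log ((‖ζ‖ ^ 2 + ε)⁻¹)) ζ :=
    (((contDiff_norm_sq ℝ).contDiffAt.add contDiffAt_const).inv h).log (inv_ne_zero h)
  exact (contDiff_id.pow p).contDiffAt.mul
    (Complex.ofRealCLM.contDiff.contDiffAt.comp ζ (hH.contDiff.contDiffAt.comp ζ h1))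

theorem contDiff_powMulLog (hH : IsLogCutoff H) (hε : 0 < ε) : ContDiff ℝ ∞ (powMulLog p H ε) :=
  contDiff_iff_contDiffAt.2 fun ζ => hH.contDiffAt_powMulLog (by positivity)

theorem continuous_powMulLog (hH : IsLogCutoff H) (hp : 1 ≤ p) (hε : 0 ≤ ε) :
    Continuous (powMulLog p H ε) := by
  refine continuous_iff_continuousAt.2 fun ζ => ?_
  by_cases hζ : ζ = 0
  · rw [hζ, ContinuousAt, show powMulLog p H ε 0 = 0 by
      simp [powMulLog, zero_pow (show p ≠ 0 by omega)]]
    refine squeeze_zero_norm (hH.norm_powMulLog_le hp hε) ?_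
    have h1 : Continuous fun ζ : ℂ => ‖ζ‖ * Real.log ‖ζ‖ :=
      Real.continuous_mul_log.comp continuous_norm
    have h2 : Tendsto (fun ζ : ℂ => ‖ζ‖ ^ (p - 1) * (2 * |‖ζ‖ * Real.log ‖ζ‖|)) (𝓝 0)
        (𝓝 (‖(0 : ℂ)‖ ^ (p - 1) * (2 * |‖(0 : ℂ)‖ * Real.log ‖(0 : ℂ)‖|))) :=
      Continuous.tendsto (by fun_prop) 0
    simpa using h2
  · have : 0 < ‖ζ‖ := norm_pos_iff.2 hζ
    exact (hH.contDiffAt_powMulLog (by positivity)).continuousAt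

theorem powMulLogDbar_zero_eq (ζ : ℂ) :
    powMulLogDbar p H 0 ζ = -logPower p (-1) (deriv H) ζ := by
  by_cases hζ : ζ = 0
  · simp [hζ, powMulLogDbar, logPower]
  · have hn : ((‖ζ‖ ^ 2 : ℝ) : ℂ) = ζ * conj ζ := by
      rw [Complex.mul_conj, Complex.normSq_eq_norm_sq]
    have hζ' : conj ζ ≠ 0 := by simpa using hζ
    rw [powMulLogDbar, logPower, add_zero, Complex.ofReal_div, hn, zpow_natCast, zpow_neg_one]
    field_simp
    ring

theorem isDecayingProfile_deriv (hH : IsLogCutoff H) : IsDecayingProfile (deriv H) :=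
  .deriv_log_cutoff hH.contDiff hH.eq_zero hH.eventually_eq_log

/-- For `ε = 0` the function is minus a monomial of total degree `p - 1` times the decaying profile
`H'`, so continuity at the origin holds even for `p = 1`. -/
theorem continuous_powMulLogDbar (hH : IsLogCutoff H) (hp : 1 ≤ p) (hε : 0 ≤ ε) :
    Continuous (powMulLogDbar p H ε) := by
  rcases hε.eq_or_lt with rfl | hε
  · rw [funext powMulLogDbar_zero_eq]
    exact (hH.isDecayingProfile_deriv.continuous_logPower (n := p - 1)
      (by rw [Nat.cast_sub hp]; push_cast; ring)).neg
  · have h1 : ∀ ζ : ℂ, ‖ζ‖ ^ 2 + ε ≠ 0 := fun ζ => by positivity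
    have h2 : Continuous fun ζ : ℂ => Real.log ((‖ζ‖ ^ 2 + ε)⁻¹) :=
      Continuous.log (Continuous.inv₀ (by fun_prop) h1) fun ζ => inv_ne_zero (h1 ζ)
    have h3 := hH.isDecayingProfile_deriv.contDiff.continuous.comp h2
    exact ((continuous_id.pow _).mul
      (Complex.continuous_ofReal.comp (h3.div (by fun_prop) h1))).neg

theorem tendsto_powMulLog (hH : IsLogCutoff H) (hp : 1 ≤ p) (ζ : ℂ) :
    Tendsto (fun k : ℕ => powMulLog p H (1 / (k + 1)) ζ) atTop (𝓝 (powMulLog p H 0 ζ)) := by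
  by_cases hζ : ζ = 0
  · simp [hζ, powMulLog, zero_pow (show p ≠ 0 by omega)]
  have h0 : 0 < ‖ζ‖ := norm_pos_iff.2 hζ
  have h1 : ContinuousAt (fun ε : ℝ => powMulLog p H ε ζ) 0 := by
    have h2 : ContinuousAt (fun ε : ℝ => Real.log ((‖ζ‖ ^ 2 + ε)⁻¹)) 0 :=
      ContinuousAt.log (ContinuousAt.inv₀ (by fun_prop) (by positivity)) (by positivity)
    exact continuousAt_const.mul (Complex.continuous_ofReal.continuousAt.comp
      (hH.contDiff.continuous.continuousAt.comp h2))
  exact h1.tendsto.comp tendsto_one_div_add_atTop_nhds_zero_nat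

theorem tendsto_powMulLogDbar (hH : IsLogCutoff H) (ζ : ℂ) :
    Tendsto (fun k : ℕ => powMulLogDbar p H (1 / (k + 1)) ζ) atTop
      (𝓝 (powMulLogDbar p H 0 ζ)) := by
  by_cases hζ : ζ = 0
  · simp [hζ, powMulLogDbar]
  have h0 : 0 < ‖ζ‖ := norm_pos_iff.2 hζ
  have h1 : ContinuousAt (fun ε : ℝ => powMulLogDbar p H ε ζ) 0 := by
    have h2 : ContinuousAt (fun ε : ℝ => Real.log ((‖ζ‖ ^ 2 + ε)⁻¹)) 0 :=
      ContinuousAt.log (ContinuousAt.inv₀ (by fun_prop) (by positivity)) (by positivity)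
    have h3 := ContinuousAt.comp (g := deriv H) (f := fun ε : ℝ => Real.log ((‖ζ‖ ^ 2 + ε)⁻¹))
      hH.isDecayingProfile_deriv.contDiff.continuous.continuousAt h2
    exact (continuousAt_const.mul (Complex.continuous_ofReal.continuousAt.comp
      (h3.div (by fun_prop) (by positivity)))).neg
  exact h1.tendsto.comp tendsto_one_div_add_atTop_nhds_zero_nat

theorem hasCompactSupport_powMulLog (hH : IsLogCutoff H) : HasCompactSupport (powMulLog p H 0) := by
  refine HasCompactSupport.intro (isCompact_closedBall (0 : ℂ) 1) fun ζ hζ => ?_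
  have h1 : 1 ≤ ‖ζ‖ := by simpa using (lt_of_not_ge fun h => hζ (mem_closedBall_zero_iff.2 h)).le
  rw [powMulLog, hH.eq_zero, Complex.ofReal_zero, mul_zero]
  refine (Real.log_nonpos (by positivity) (inv_le_one_of_one_le₀ ?_)).trans zero_le_one
  rw [add_zero]
  exact one_le_pow₀ h1

/-- The weak equation `∂̄ (lam ∘ ℓ) = φ ∘ ℓ * conj ℓ`. -/
theorem integral_powMulLog_mul_dbar (hH : IsLogCutoff H) (hp : 1 ≤ p) {V : Type*}
    [NormedAddCommGroup V] [NormedSpace ℂ V] [FiniteDimensional ℝ V] [MeasurableSpace V]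
    [BorelSpace V] (μ : Measure V) [μ.IsAddHaarMeasure] (ℓ : V →L[ℂ] ℂ) {g : V → ℂ}
    (hg : ContDiff ℝ 1 g) (hgc : HasCompactSupport g) (v : V) :
    ∫ z, powMulLog p H 0 (ℓ z) * dbar g z v ∂μ =
      -∫ z, powMulLogDbar p H 0 (ℓ z) * conj (ℓ v) * g z ∂μ := by
  have hdc := hg.continuous_dbar v
  have hgc' := hg.continuous
  have hε : ∀ k : ℕ, (0 : ℝ) < 1 / (k + 1) := fun k => by positivity
  -- The potential need not be differentiable at zero, so integration by parts is done for the
  -- smooth regularizations with `ε = 1/(k+1)`, and both sides pass to the limit with majorants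
  -- independent of `ε`.
  have h1 : Tendsto (fun k : ℕ => ∫ z, powMulLog p H (1 / (k + 1)) (ℓ z) * dbar g z v ∂μ) atTop
      (𝓝 (∫ z, powMulLog p H 0 (ℓ z) * dbar g z v ∂μ)) := by
    refine tendsto_integral_of_dominated_convergence
      (fun z => ‖ℓ z‖ ^ (p - 1) * (2 * |‖ℓ z‖ * Real.log ‖ℓ z‖|) * ‖dbar g z v‖)
      (fun k => (((hH.continuous_powMulLog hp (hε k).le).comp ℓ.continuous).mul
        hdc).aestronglyMeasurable) ?_ (fun k => ae_of_all _ fun z => ?_)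
      (ae_of_all _ fun z => (hH.tendsto_powMulLog hp (ℓ z)).mul_const _)
    · refine Continuous.integrable_of_hasCompactSupport ?_ (hgc.dbar v).norm.mul_left
      have h1 : Continuous fun z => ‖ℓ z‖ * Real.log ‖ℓ z‖ :=
        Real.continuous_mul_log.comp ℓ.continuous.norm
      fun_prop
    · rw [norm_mul]
      gcongr
      exact hH.norm_powMulLog_le hp (hε k).le _
  have h2 : Tendsto
      (fun k : ℕ => -∫ z, powMulLogDbar p H (1 / (k + 1)) (ℓ z) * conj (ℓ v) * g z ∂μ) atTop
      (𝓝 (-∫ z, powMulLogDbar p H 0 (ℓ z) * conj (ℓ v) * g z ∂μ)) := by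
    refine (tendsto_integral_of_dominated_convergence
      (fun z => ‖ℓ z‖ ^ (p - 1) * ‖conj (ℓ v)‖ * ‖g z‖)
      (fun k => ((((hH.continuous_powMulLogDbar hp (hε k).le).comp ℓ.continuous).mul
        continuous_const).mul hgc').aestronglyMeasurable) ?_ (fun k => ae_of_all _ fun z => ?_)
      (ae_of_all _ fun z => ((hH.tendsto_powMulLogDbar (ℓ z)).mul_const _).mul_const _)).neg
    · exact Continuous.integrable_of_hasCompactSupport (by fun_prop) hgc.norm.mul_left
    · change ‖powMulLogDbar p H (1 / (k + 1)) (ℓ z) * conj (ℓ v) * g z‖ ≤ _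
      rw [norm_mul, norm_mul]
      gcongr
      exact hH.norm_powMulLogDbar_le hp (hε k).le _
  refine tendsto_nhds_unique (h1.congr fun k => ?_) h2
  have hs : ContDiff ℝ 1 fun z => powMulLog p H (1 / (k + 1)) (ℓ z) :=
    ((hH.contDiff_powMulLog (hε k)).of_le (by simp)).comp (ℓ.restrictScalars ℝ).contDiff
  rw [integral_mul_dbar_eq_neg μ hs hg hgc v]
  congr 2
  ext z
  have hne : ‖ℓ z‖ ^ 2 + 1 / ((k : ℝ) + 1) ≠ 0 := by positivity
  obtain ⟨A, hA⟩ := hasFDerivAt_powMulLog (p := p) hH.differentiable hne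
  rw [dbar_comp_of_hasFDerivAt ℓ hA]

end IsLogCutoff

/-! ### Taylor coefficients by circle integrals, and averaging over roots of unity. -/

/-- The integral of `q(z) / z ^ (p + 1)` over the circle of radius `ρ`, which is `2πi` times the
`p`-th Taylor coefficient of `q` if `q` is holomorphic. -/
noncomputable def circleCoeff (p : ℕ) (ρ : ℝ) (q : ℂ → ℂ) : ℂ :=
  ∮ z in C(0, ρ), q z / z ^ (p + 1)

theorem continuousOn_sphere_div_pow {p : ℕ} {ρ : ℝ} (hρ : 0 < ρ) {q : ℂ → ℂ}
    (hq : ContinuousOn q (Metric.sphere 0 ρ)) :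
    ContinuousOn (fun z => q z / z ^ (p + 1)) (Metric.sphere 0 ρ) :=
  hq.div (by fun_prop) fun z hz => pow_ne_zero _ (Metric.ne_of_mem_sphere hz hρ.ne')

theorem circleCoeff_sub {p : ℕ} {ρ : ℝ} (hρ : 0 < ρ) {q r : ℂ → ℂ}
    (hq : ContinuousOn q (Metric.sphere 0 ρ)) (hr : ContinuousOn r (Metric.sphere 0 ρ)) :
    circleCoeff p ρ (fun z => q z - r z) = circleCoeff p ρ q - circleCoeff p ρ r := by
  rw [circleCoeff, circleCoeff, circleCoeff, ← circleIntegral.integral_sub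
    ((continuousOn_sphere_div_pow hρ hq).circleIntegrable hρ.le)
    ((continuousOn_sphere_div_pow hρ hr).circleIntegrable hρ.le)]
  simp_rw [sub_div]

theorem circleCoeff_sum {p : ℕ} {ρ : ℝ} (hρ : 0 < ρ) {α : Type*} (s : Finset α) {q : α → ℂ → ℂ}
    (hq : ∀ a ∈ s, ContinuousOn (q a) (Metric.sphere 0 ρ)) :
    circleCoeff p ρ (fun z => ∑ a ∈ s, q a z) = ∑ a ∈ s, circleCoeff p ρ (q a) := by
  simp_rw [circleCoeff, Finset.sum_div]
  exact circleIntegral.integral_fun_sum fun a ha =>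
    (continuousOn_sphere_div_pow hρ (hq a ha)).circleIntegrable hρ.le

theorem norm_circleCoeff_le {p : ℕ} {ρ : ℝ} (hρ : 0 < ρ) {q : ℂ → ℂ} {M : ℝ}
    (hq : ∀ z, ‖z‖ = ρ → ‖q z‖ ≤ M) : ‖circleCoeff p ρ q‖ ≤ 2 * Real.pi * (M / ρ ^ p) := by
  have := circleIntegral.norm_integral_le_of_norm_le_const (f := fun z => q z / z ^ (p + 1))
    (c := 0) (R := ρ) (C := M / ρ ^ (p + 1)) hρ.le fun z hz => by
      have hz' : ‖z‖ = ρ := by simpa using hz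
      rw [norm_div, norm_pow, hz']
      gcongr
      exact hq z hz'
  refine this.trans (le_of_eq ?_)
  rw [pow_succ]
  field_simp

theorem circleCoeff_radius_eq {p : ℕ} {R ρ ρ' : ℝ} {q : ℂ → ℂ}
    (hq : DifferentiableOn ℂ q (Metric.ball 0 R)) (hρ' : 0 < ρ') (h : ρ' ≤ ρ) (hR : ρ < R) :
    circleCoeff p ρ q = circleCoeff p ρ' q := by
  have hd : ∀ z ∈ Metric.closedBall (0 : ℂ) ρ \ Metric.ball 0 ρ',
      DifferentiableAt ℂ (fun z => q z / z ^ (p + 1)) z := by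
    intro z hz
    have h0 : z ≠ 0 := by
      rintro rfl
      exact hz.2 (Metric.mem_ball_self hρ')
    have hz1 : z ∈ Metric.ball (0 : ℂ) R := Metric.closedBall_subset_ball hR hz.1
    exact (hq.differentiableAt (Metric.isOpen_ball.mem_nhds hz1)).div (by fun_prop)
      (pow_ne_zero _ h0)
  refine Complex.circleIntegral_eq_of_differentiable_on_annulus_off_countable hρ' h
    countable_empty (fun z hz => (hd z hz).continuousAt.continuousWithinAt) fun z hz => hd z ?_
  exact ⟨Metric.ball_subset_closedBall hz.1.1, fun h' => hz.1.2 (Metric.ball_subset_closedBall h')⟩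

/-- The integral does not depend on the radius, and on a circle of radius `ρ'` it is `O(ρ')`. The
constant `q 0` contributes nothing because `p ≥ 1`. -/
theorem circleCoeff_eq_zero {p : ℕ} (hp : 1 ≤ p) {R ρ C : ℝ} {q : ℂ → ℂ}
    (hq : DifferentiableOn ℂ q (Metric.ball 0 R)) (hρ : 0 < ρ) (hR : ρ < R)
    (hC : ∀ z, ‖z‖ < R → ‖q z - q 0‖ ≤ C * ‖z‖ ^ (p + 1)) : circleCoeff p ρ q = 0 := by
  have hconst : ∀ ρ' : ℝ, circleCoeff p ρ' (fun _ => q 0) = 0 := by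
    intro ρ'
    have h1 := circleIntegral.integral_sub_zpow_of_ne (n := -(p + 1 : ℕ))
      (by push_cast; omega) 0 0 ρ'
    rw [circleCoeff]
    simp_rw [div_eq_mul_inv]
    rw [circleIntegral.integral_const_mul]
    simp only [sub_zero, zpow_neg, zpow_natCast] at h1
    rw [h1, mul_zero]
  have hqc : ∀ ρ' < R, ContinuousOn q (Metric.sphere 0 ρ') := fun ρ' h =>
    hq.continuousOn.mono fun z hz => by
      have : ‖z‖ = ρ' := by simpa using hz
      simpa [this] using h
  have hb : ∀ ρ' : ℝ, 0 < ρ' → ρ' ≤ ρ → ‖circleCoeff p ρ q‖ ≤ 2 * Real.pi * (C * ρ') := by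
    intro ρ' h0 h1
    have h2 : circleCoeff p ρ q = circleCoeff p ρ' (fun z => q z - q 0) := by
      rw [circleCoeff_radius_eq hq h0 h1 hR, circleCoeff_sub h0 (hqc ρ' (h1.trans_lt hR))
        continuousOn_const, hconst, sub_zero]
    rw [h2]
    refine (norm_circleCoeff_le h0 (M := C * ρ' ^ (p + 1)) fun z hz => ?_).trans (le_of_eq ?_)
    · simpa [hz] using hC z (by rw [hz]; exact h1.trans_lt hR)
    · rw [pow_succ]
      field_simp
  have hlim : Tendsto (fun ρ' : ℝ => 2 * Real.pi * (C * ρ')) (𝓝[>] 0) (𝓝 0) := by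
    have h1 : Tendsto (fun ρ' : ℝ => 2 * Real.pi * (C * ρ')) (𝓝 0) (𝓝 (2 * Real.pi * (C * 0))) :=
      Continuous.tendsto (by fun_prop) 0
    rw [mul_zero, mul_zero] at h1
    exact h1.mono_left nhdsWithin_le_nhds
  refine norm_le_zero_iff.1 (ge_of_tendsto hlim ?_)
  filter_upwards [Ioc_mem_nhdsGT hρ] with ρ' h using hb ρ' h.1 h.2

/-- A Schwarz lemma for holomorphic functions that are invariant under a rotation of order `p`. -/
theorem norm_sub_le_of_rotation_invariant {p : ℕ} (hp : 1 ≤ p) {η : ℂ} (hη : IsPrimitiveRoot η p)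
    {R M : ℝ} {g : ℂ → ℂ} (hg : DifferentiableOn ℂ g (Metric.ball 0 R))
    (hinv : ∀ z, ‖z‖ < R → g (η * z) = g z) (hM : ∀ z, ‖z‖ < R → ‖g z - g 0‖ ≤ M) {z : ℂ}
    (hz : ‖z‖ < R) : ‖g z - g 0‖ ≤ M * (‖z‖ / R) ^ p := by
  have hR : 0 < R := (norm_nonneg z).trans_lt hz
  have hball : Metric.ball (0 : ℂ) R ∈ 𝓝 0 := Metric.ball_mem_nhds _ hR
  have han : AnalyticAt ℂ (fun z => g z - g 0) 0 :=
    (hg.sub (differentiableOn_const _)).analyticAt hball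
  have hord : (fun z => g z - g 0) =o[𝓝 0] fun z : ℂ => ‖z - 0‖ ^ (p - 1) := by
    by_cases htop : analyticOrderAt (fun z => g z - g 0) 0 = ⊤
    · exact (Asymptotics.isLittleO_zero _ _).congr'
        ((analyticOrderAt_eq_top.1 htop).mono fun z hz => hz.symm) EventuallyEq.rfl
    obtain ⟨h, hh, hh0, hEq⟩ := han.analyticOrderAt_ne_top.1 htop
    set m := analyticOrderNatAt (fun z => g z - g 0) 0
    simp only [sub_zero, smul_eq_mul] at hEq
    have hm0 : m ≠ 0 := by
      intro hm
      have := hEq.self_of_nhds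
      rw [hm] at this
      simp [hh0.symm] at this
    have hrot : Tendsto (fun z : ℂ => η * z) (𝓝 0) (𝓝 0) := by
      have : Tendsto (fun z : ℂ => η * z) (𝓝 0) (𝓝 (η * 0)) := Continuous.tendsto (by fun_prop) 0
      rwa [mul_zero] at this
    -- Comparing leading terms of `g(ηz) = g(z)` forces `p ∣ m` for the order of vanishing `m` of `g
    -- - g 0`; as `m ≠ 0`, it is at least `p`.
    have hpow : η ^ m * h 0 = h 0 := by
      have h1 : ∀ᶠ z in 𝓝[≠] (0 : ℂ), η ^ m * h (η * z) = h z := by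
        filter_upwards [nhdsWithin_le_nhds hEq, nhdsWithin_le_nhds (hrot.eventually hEq),
          nhdsWithin_le_nhds hball, self_mem_nhdsWithin] with z h1 h2 h3 h4
        have h4 : z ≠ 0 := h4
        rw [hinv z (by simpa using h3), h1, mul_pow] at h2
        have := pow_ne_zero m h4
        apply mul_left_cancel₀ this
        linear_combination -h2
      have h2 : Tendsto (fun z => η ^ m * h (η * z)) (𝓝[≠] 0) (𝓝 (η ^ m * h 0)) :=
        ((hh.continuousAt.tendsto.comp hrot).const_mul _).mono_left nhdsWithin_le_nhds
      exact tendsto_nhds_unique (h2.congr' h1)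
        (hh.continuousAt.tendsto.mono_left nhdsWithin_le_nhds)
    have hpm : p ≤ m := Nat.le_of_dvd (Nat.pos_of_ne_zero hm0)
      (hη.dvd_of_pow_eq_one m (by simpa [hh0] using hpow))
    have h3 : (fun z : ℂ => z ^ (p - 1) * (z ^ (m - (p - 1)) * h z)) =o[𝓝 0]
        fun z : ℂ => z ^ (p - 1) * 1 := by
      refine (Asymptotics.isBigO_refl _ _).mul_isLittleO ((Asymptotics.isLittleO_one_iff ℂ).2 ?_)
      have h4 : Tendsto (fun z : ℂ => z ^ (m - (p - 1)) * h z) (𝓝 0)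
          (𝓝 (0 ^ (m - (p - 1)) * h 0)) :=
        (Continuous.tendsto (by fun_prop) _).mul hh.continuousAt.tendsto
      rwa [zero_pow (by omega), zero_mul] at h4
    have h5 := (h3.congr' (f₂ := fun z => g z - g 0) ?_ EventuallyEq.rfl).norm_right
    · simpa using h5
    · filter_upwards [hEq] with z hz
      rw [hz, ← mul_assoc, ← pow_add]
      congr 2
      omega
  have key := Complex.dist_le_mul_div_pow_of_mapsTo_ball_of_isLittleO (z := z) (R₂ := M) hg
    (fun w hw => by
      rw [Metric.mem_closedBall, dist_eq_norm]
      exact hM w (by simpa using hw)) hord (by simpa using hz)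
  rwa [dist_eq_norm, dist_zero_right, Nat.sub_add_cancel hp] at key

/-- For a bounded function on a polydisc that is holomorphic on complex lines, the average over
`p`-th roots of unity of the `p`-th coefficients along diagonals is the sum of the coefficients
along the axes. -/
theorem sum_circleCoeff_diagonal_eq {p : ℕ} [NeZero p] [Fintype (rootsOfUnity p ℂ)]
    {ι : Type*} [Fintype ι] [DecidableEq ι]
    {v : (ι → ℂ) → ℂ} {R M ρ : ℝ}
    (hv : ∀ x y : ι → ℂ, DifferentiableOn ℂ (fun ζ : ℂ => v (x + ζ • y))
      {ζ | ∀ i, ‖x i + ζ * y i‖ < R})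
    (hM : ∀ w : ι → ℂ, (∀ i, ‖w i‖ < R) → ‖v w‖ ≤ M) (hρ : 0 < ρ) (hR : ρ < R) :
    ∑ a : ι → rootsOfUnity p ℂ, circleCoeff p ρ (fun ζ => v (ζ • fun i => ((a i : ℂˣ) : ℂ))) =
      ∑ i, ∑ a : ι → rootsOfUnity p ℂ,
        circleCoeff p ρ (fun ζ => v (ζ • Pi.single i ((a i : ℂˣ) : ℂ))) := by
  have hp : 1 ≤ p := NeZero.one_le
  have hR0 : 0 < R := hρ.trans hR
  have hroot : ∀ b : rootsOfUnity p ℂ, ‖((b : ℂˣ) : ℂ)‖ = 1 := fun b =>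
    Complex.norm_eq_one_of_mem_rootsOfUnity b.2
  let rot : (ι → rootsOfUnity p ℂ) → (ι → ℂ) → ι → ℂ := fun a w i => ((a i : ℂˣ) : ℂ) * w i
  -- The average (without normalization) over all coordinatewise rotations. Being invariant, it has
  -- no monomials except those whose exponents are all divisible by `p`; in degree `p` these are
  -- pure powers `w_i^p`.
  let V : (ι → ℂ) → ℂ := fun w => ∑ a : ι → rootsOfUnity p ℂ, v (rot a w)
  have hrot : ∀ a w i, ‖rot a w i‖ = ‖w i‖ := fun a w i => by
    simp only [rot]
    rw [norm_mul, hroot, one_mul]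
  have hVinv : ∀ b w, V (rot b w) = V w := by
    intro b w
    refine Fintype.sum_equiv (Equiv.mulRight b) _ _ fun a => ?_
    congr 1
    ext i
    simp [rot, mul_assoc]
  have hVd : ∀ x y : ι → ℂ, DifferentiableOn ℂ (fun ζ : ℂ => V (x + ζ • y))
      {ζ | ∀ i, ‖x i + ζ * y i‖ < R} := by
    intro x y
    refine DifferentiableOn.fun_sum fun a _ => ?_
    have h1 := hv (rot a x) (rot a y)
    have h2 : ∀ ζ : ℂ, rot a (x + ζ • y) = rot a x + ζ • rot a y := by
      intro ζ
      ext i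
      simp only [rot, Pi.add_apply, Pi.smul_apply, smul_eq_mul]
      ring
    simp_rw [h2]
    refine h1.mono fun ζ hζ i => ?_
    have h3 : rot a x i + ζ * rot a y i = rot a (x + ζ • y) i := by rw [h2]; simp
    rw [h3, hrot]
    simpa using hζ i
  obtain ⟨N, hN⟩ : ∃ N : ℝ, ∀ w : ι → ℂ, (∀ i, ‖w i‖ < R) → ‖V w‖ ≤ N :=
    ⟨∑ _a : ι → rootsOfUnity p ℂ, M, fun w hw =>
      norm_sum_le_of_le _ fun a _ => hM _ fun i => by rw [hrot]; exact hw i⟩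
  let e : Finset ι → ι → ℂ := fun S j => if j ∈ S then 1 else 0
  obtain ⟨η, hη⟩ : ∃ η : rootsOfUnity p ℂ, IsPrimitiveRoot ((η : ℂˣ) : ℂ) p := by
    have h := Complex.isPrimitiveRoot_exp p (NeZero.ne p)
    exact ⟨h.toRootsOfUnity, h⟩
  have hmem : ∀ (S : Finset ι) (i : ι), i ∉ S → ∀ ζ w : ℂ, ‖ζ‖ < R → ‖w‖ < R →
      ∀ j, ‖ζ * e S j + w * e {i} j‖ < R := by
    intro S i hi ζ w hζ hw j
    by_cases hji : j = i
    · subst hji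
      simpa [e, hi] using hw
    · by_cases hjS : j ∈ S
      · simpa [e, hji, hjS] using hζ
      · simpa [e, hji, hjS] using hR0
  -- One-variable Schwarz lemmas replace the power series in several variables. The mixed difference
  -- vanishes to order `p` in `ζ` by rotation invariance and to order one in `w`, so on `w = ζ` it
  -- is `O(|ζ|^(p+1))` and does not affect the `p`-th coefficient.
  have hmix : ∀ (S : Finset ι) (i : ι), i ∉ S → ∀ ζ w : ℂ, ‖ζ‖ < R → ‖w‖ < R →
      ‖V (ζ • e S + w • e {i}) - V (ζ • e S) - (V (w • e {i}) - V 0)‖ ≤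
        4 * N * (‖ζ‖ / R) ^ p * (‖w‖ / R) := by
    intro S i hi
    have hb : ∀ ζ w : ℂ, ‖ζ‖ < R → ‖w‖ < R → ‖V (ζ • e S + w • e {i})‖ ≤ N :=
      fun ζ w hζ hw => hN _ fun j => by simpa using hmem S i hi ζ w hζ hw j
    have h0 : ‖(0 : ℂ)‖ < R := by simpa using hR0
    have hd1 : ∀ w : ℂ, ‖w‖ < R →
        DifferentiableOn ℂ (fun ζ : ℂ => V (ζ • e S + w • e {i})) (Metric.ball 0 R) := by
      intro w hw
      simp_rw [add_comm _ (w • e {i})]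
      refine (hVd (w • e {i}) (e S)).mono fun ζ hζ j => ?_
      rw [add_comm]
      exact hmem S i hi ζ w (by simpa using hζ) hw j
    have hd2 : ∀ ζ : ℂ, ‖ζ‖ < R →
        DifferentiableOn ℂ (fun w : ℂ => V (ζ • e S + w • e {i})) (Metric.ball 0 R) := by
      intro ζ hζ
      exact (hVd (ζ • e S) (e {i})).mono fun w hw j => hmem S i hi ζ w hζ (by simpa using hw) j
    have hinv : ∀ ζ w : ℂ, V ((((η : ℂˣ) : ℂ) * ζ) • e S + w • e {i}) =
        V (ζ • e S + w • e {i}) := by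
      intro ζ w
      -- Rotating every coordinate except `i` acts on the block `S` alone, as `i ∉ S`.
      rw [← hVinv (fun j => if j = i then 1 else η) (ζ • e S + w • e {i})]
      congr 1
      ext j
      by_cases hji : j = i
      · subst hji
        simp [rot, e, hi]
      · simp [rot, e, hji]
    have step1 : ∀ ζ w : ℂ, ‖ζ‖ < R → ‖w‖ < R →
        ‖V (ζ • e S + w • e {i}) - V (ζ • e S) - (V (w • e {i}) - V 0)‖ ≤
          4 * N * (‖ζ‖ / R) ^ p := by
      intro ζ w hζ hw
      have hd := (hd1 w hw).sub (hd1 0 h0)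
      have hb4 : ∀ z : ℂ, ‖z‖ < R →
          ‖(V (z • e S + w • e {i}) - V (z • e S + (0 : ℂ) • e {i})) -
            (V ((0 : ℂ) • e S + w • e {i}) - V ((0 : ℂ) • e S + (0 : ℂ) • e {i}))‖ ≤ 4 * N := by
        intro z hz
        have b1 := hb z w hz hw
        have b2 := hb z 0 hz h0
        have b3 := hb 0 w h0 hw
        have b4 := hb 0 0 h0 h0
        have b5 := norm_sub_le (V (z • e S + w • e {i})) (V (z • e S + (0 : ℂ) • e {i}))
        have b6 := norm_sub_le (V ((0 : ℂ) • e S + w • e {i})) (V ((0 : ℂ) • e S + (0 : ℂ) • e {i}))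
        refine (norm_sub_le _ _).trans ?_
        linarith
      have := norm_sub_le_of_rotation_invariant hp hη
        (g := fun ζ => V (ζ • e S + w • e {i}) - V (ζ • e S + (0 : ℂ) • e {i})) hd
        (fun z _ => by simp only [hinv]) hb4 hζ
      simpa using this
    intro ζ w hζ hw
    have hd := (((hd2 ζ hζ).sub_const (V (ζ • e S))).sub ((hd2 0 h0).sub_const (V 0)))
    have := Complex.dist_le_div_mul_dist_of_mapsTo_ball (R₂ := 4 * N * (‖ζ‖ / R) ^ p) (z := w)
      (f := fun w : ℂ => V (ζ • e S + w • e {i}) - V (ζ • e S) -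
        (V ((0 : ℂ) • e S + w • e {i}) - V 0)) hd (fun z hz => by
          rw [Metric.mem_closedBall, dist_eq_norm]
          simpa using step1 ζ z hζ (by simpa using hz)) (by simpa using hw)
    rw [dist_eq_norm] at this
    simp only [zero_smul, add_zero, zero_add, sub_self, sub_zero, dist_zero_right] at this
    refine this.trans (le_of_eq ?_)
    ring
  -- Coordinates are added to the diagonal one at a time, each at the cost of one mixed difference.
  have hdiag : ∀ S : Finset ι, ∃ C : ℝ, ∀ ζ : ℂ, ‖ζ‖ < R →
      ‖V (ζ • e S) - V 0 - ∑ i ∈ S, (V (ζ • e {i}) - V 0)‖ ≤ C * ‖ζ‖ ^ (p + 1) := by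
    intro S
    induction S using Finset.induction_on with
    | empty =>
      refine ⟨0, fun ζ _ => ?_⟩
      have : ζ • e ∅ = 0 := by ext; simp [e]
      simp [this]
    | insert i S hi ih =>
      obtain ⟨C, hC⟩ := ih
      refine ⟨C + 4 * N / R ^ (p + 1), fun ζ hζ => ?_⟩
      have h1 : ζ • e (insert i S) = ζ • e S + ζ • e {i} := by
        ext j
        by_cases hji : j = i
        · subst hji
          simp [e, hi]
        · simp [e, hji]
      rw [Finset.sum_insert hi, h1]
      have h2 := hmix S i hi ζ ζ hζ hζ
      have h3 := hC ζ hζ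
      have h4 : V (ζ • e S + ζ • e {i}) - V 0 -
          (V (ζ • e {i}) - V 0 + ∑ i ∈ S, (V (ζ • e {i}) - V 0)) =
          (V (ζ • e S + ζ • e {i}) - V (ζ • e S) - (V (ζ • e {i}) - V 0)) +
            (V (ζ • e S) - V 0 - ∑ i ∈ S, (V (ζ • e {i}) - V 0)) := by ring
      rw [h4]
      refine (norm_add_le _ _).trans ((add_le_add h2 h3).trans (le_of_eq ?_))
      rw [div_pow, pow_succ, pow_succ]
      field_simp
      ring
  obtain ⟨C, hC⟩ := hdiag Finset.univ
  have hdV : ∀ S : Finset ι, DifferentiableOn ℂ (fun ζ : ℂ => V (ζ • e S)) (Metric.ball 0 R) := by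
    intro S
    have := hVd 0 (e S)
    simp only [zero_add, Pi.zero_apply] at this
    refine this.mono fun ζ hζ i => ?_
    by_cases hi : i ∈ S
    · simpa [e, hi] using hζ
    · simpa [e, hi] using hR0
  have hzero : circleCoeff p ρ (fun ζ => V (ζ • e Finset.univ) - ∑ i, V (ζ • e {i})) = 0 := by
    refine circleCoeff_eq_zero hp (C := C)
      ((hdV _).sub (DifferentiableOn.fun_sum fun i _ => hdV _)) hρ hR fun z hz => ?_
    have := hC z hz
    rw [Finset.sum_sub_distrib] at this
    simp only [zero_smul]
    refine le_trans (le_of_eq ?_) this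
    congr 1
    ring
  have hsph : Metric.sphere (0 : ℂ) ρ ⊆ Metric.ball 0 R :=
    Metric.sphere_subset_closedBall.trans (Metric.closedBall_subset_ball hR)
  rw [circleCoeff_sub hρ ((hdV _).continuousOn.mono hsph)
    (continuousOn_finsetSum _ fun i _ => (hdV _).continuousOn.mono hsph),
    circleCoeff_sum hρ _ fun i _ => (hdV _).continuousOn.mono hsph, sub_eq_zero] at hzero
  have hdv : ∀ (S : Finset ι) (a : ι → rootsOfUnity p ℂ),
      ContinuousOn (fun ζ : ℂ => v (rot a (ζ • e S))) (Metric.sphere 0 ρ) := by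
    intro S a
    have h1 := hv 0 (rot a (e S))
    have h2 : ∀ ζ : ℂ, rot a (ζ • e S) = 0 + ζ • rot a (e S) := by
      intro ζ
      ext i
      simp only [rot, zero_add, Pi.smul_apply, smul_eq_mul]
      ring
    simp_rw [h2]
    refine (h1.continuousOn).mono fun ζ hζ i => ?_
    have h3 : (0 : ι → ℂ) i + ζ * rot a (e S) i = rot a (ζ • e S) i := by rw [h2]; simp
    rw [h3, hrot]
    have hζ' : ‖ζ‖ < R := by simpa using hsph hζ
    by_cases hi : i ∈ S
    · simpa [e, hi] using hζ'
    · simpa [e, hi] using hR0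
  have hsum : ∀ S : Finset ι, circleCoeff p ρ (fun ζ => V (ζ • e S)) =
      ∑ a : ι → rootsOfUnity p ℂ, circleCoeff p ρ (fun ζ => v (rot a (ζ • e S))) :=
    fun S => circleCoeff_sum hρ _ fun a _ => hdv S a
  simp_rw [hsum] at hzero
  have huniv : ∀ (a : ι → rootsOfUnity p ℂ) (ζ : ℂ),
      rot a (ζ • e Finset.univ) = ζ • fun i => ((a i : ℂˣ) : ℂ) := by
    intro a ζ
    ext j
    simp [rot, e, mul_comm]
  have hsingle : ∀ (a : ι → rootsOfUnity p ℂ) (i : ι) (ζ : ℂ),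
      rot a (ζ • e {i}) = ζ • Pi.single i ((a i : ℂˣ) : ℂ) := by
    intro a i ζ
    ext j
    by_cases hji : j = i
    · subst hji
      simp [rot, e, mul_comm]
    · simp [rot, e, hji]
  simpa only [huniv, hsingle] using hzero

/-! ### Weyl's lemma for `∂̄`, on complex lines. -/

section Weyl

variable {V : Type*} [NormedAddCommGroup V] [NormedSpace ℂ V]

/-- The form `∂̄g(z; ·)` as a conjugate-linear map. -/
noncomputable def dbarLinear (g : V → ℂ) (z : V) : V →ₗ⋆[ℂ] ℂ where
  toFun := dbar g z
  map_add' x y := by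
    simp only [dbar, smul_add, map_add]
    ring
  map_smul' c x := by
    have h1 : ∀ (c : ℂ) (x : V), fderiv ℝ g z (c • x) =
        c.re * fderiv ℝ g z x + c.im * fderiv ℝ g z (Complex.I • x) := by
      intro c x
      conv_lhs => rw [← Complex.re_add_im c, add_smul, mul_smul, map_add]
      have h2 : ∀ (r : ℝ) (x : V), fderiv ℝ g z ((r : ℂ) • x) = r * fderiv ℝ g z x := by
        intro r x
        rw [Complex.coe_smul, map_smul, Complex.real_smul]
      rw [h2, h2]
    have h3 : ∀ c : ℂ, conj c = c.re - c.im * Complex.I := fun c => by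
      apply Complex.ext <;> simp
    simp only [dbar, smul_eq_mul]
    rw [smul_smul, h1, h1 (Complex.I * c), h3]
    simp
    linear_combination
      ((c.im : ℂ) * fderiv ℝ g z (Complex.I • x) / 2) * Complex.I_sq

theorem differentiableAt_line_of_dbar_eq_zero {g : V → ℂ} (hg : Differentiable ℝ g) {x y : V}
    {ζ : ℂ} (h : dbar g (x + ζ • y) y = 0) : DifferentiableAt ℂ (fun ζ : ℂ => g (x + ζ • y)) ζ := by
  have hl : HasFDerivAt (fun ζ : ℂ => x + ζ • y)
      ((ContinuousLinearMap.toSpanSingleton ℂ y).restrictScalars ℝ) ζ :=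
    ((ContinuousLinearMap.toSpanSingleton ℂ y).hasFDerivAt.restrictScalars ℝ).const_add x
  have h1 : HasFDerivAt (fun ζ : ℂ => g (x + ζ • y)) _ ζ := (hg _).hasFDerivAt.comp ζ hl
  refine differentiableAt_complex_iff_differentiableAt_real.2 ⟨h1.differentiableAt, ?_⟩
  rw [h1.fderiv]
  simp only [ContinuousLinearMap.comp_apply, ContinuousLinearMap.coe_restrictScalars',
    ContinuousLinearMap.toSpanSingleton_apply, one_smul, smul_eq_mul]
  rw [dbar] at h
  linear_combination (-2 * Complex.I) * h +
    fderiv ℝ g (x + ζ • y) (Complex.I • y) * Complex.I_sq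

variable [FiniteDimensional ℝ V] [MeasurableSpace V] [BorelSpace V] (μ : Measure V)
  [μ.IsAddHaarMeasure]

/-- The `∂̄` of the mollification of a function. -/
theorem dbar_convolution {v : V → ℂ} (hv : LocallyIntegrable v μ) {φ : V → ℝ}
    (hφ : ContDiff ℝ 1 φ) (hφc : HasCompactSupport φ) (x y : V) :
    dbar (convolution v φ (ContinuousLinearMap.lsmul ℝ ℝ).flip μ) x y =
      -∫ t, v t * dbar (fun t => (φ (x - t) : ℂ)) t y ∂μ := by
  have hφ' := hφ.continuous_fderiv one_ne_zero
  have h1 : ∀ y, fderiv ℝ (convolution v φ (ContinuousLinearMap.lsmul ℝ ℝ).flip μ) x y =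
      ∫ t, v t * (fderiv ℝ φ (x - t) y : ℂ) ∂μ := by
    intro y
    rw [(hφc.hasFDerivAt_convolution_right _ hv hφ x).fderiv,
      convolution_precompR_apply _ hv (hφc.fderiv ℝ) hφ', convolution_def]
    simp [mul_comm]
  have h2 : ∀ t y, fderiv ℝ (fun t => (φ (x - t) : ℂ)) t y = -(fderiv ℝ φ (x - t) y : ℂ) := by
    intro t y
    have h3 : HasFDerivAt (fun t => x - t) (-ContinuousLinearMap.id ℝ V) t :=
      (hasFDerivAt_id t).const_sub x
    have h4 : HasFDerivAt (fun t => (φ (x - t) : ℂ)) _ t :=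
      Complex.ofRealCLM.hasFDerivAt.comp t
        ((hφ.differentiable one_ne_zero (x - t)).hasFDerivAt.comp t h3)
    rw [h4.fderiv]
    simp
  have hint : ∀ y, Integrable (fun t => v t * (fderiv ℝ φ (x - t) y : ℂ)) μ := by
    intro y
    have h3 : Integrable (fun t => (ContinuousLinearMap.lsmul ℝ ℝ : ℝ →L[ℝ] ℂ →L[ℝ] ℂ).flip (v t)
        (fderiv ℝ φ (x - t) y)) μ :=
      (hφc.fderiv_apply ℝ y).convolutionExists_right _ hv
        (g := fun z => fderiv ℝ φ z y) (by fun_prop) x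
    simpa [mul_comm] using h3
  simp only [dbar, h1, h2]
  have h5 : ∀ t, v t * (1 / 2 * (-(fderiv ℝ φ (x - t) y : ℂ) +
      Complex.I * -(fderiv ℝ φ (x - t) (Complex.I • y) : ℂ))) =
      (-1 / 2) * (v t * (fderiv ℝ φ (x - t) y : ℂ)) +
        (-1 / 2 * Complex.I) * (v t * (fderiv ℝ φ (x - t) (Complex.I • y) : ℂ)) := by
    intro t
    ring
  simp_rw [h5]
  rw [integral_add ((hint _).const_mul _) ((hint _).const_mul _), integral_const_mul,
    integral_const_mul]
  ring

/-- Weyl's lemma: a continuous function that is weakly annihilated by `∂̄` is holomorphic on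
complex lines. -/
theorem differentiableOn_line_of_weak_dbar_eq_zero {D : Set V} (hD : IsOpen D) {v : V → ℂ}
    (hv : ContinuousOn v D)
    (hw : ∀ g : V → ℂ, ContDiff ℝ ∞ g → HasCompactSupport g → tsupport g ⊆ D →
      ∀ y, ∫ z, v z * dbar g z y ∂μ = 0) (x y : V) :
    DifferentiableOn ℂ (fun ζ : ℂ => v (x + ζ • y)) {ζ | x + ζ • y ∈ D} := by
  have hline : Continuous fun ζ : ℂ => x + ζ • y := by fun_prop
  intro ζ₀ hζ₀
  have : ProperSpace V := FiniteDimensional.proper_real V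
  obtain ⟨r', hr', hr'D⟩ := Metric.nhds_basis_closedBall.mem_iff.1 (hD.mem_nhds hζ₀)
  -- Mollifiers of radius at most `r`, centred in the ball of radius `r`, are supported in the ball
  -- of radius `2r`, which still lies in `D`.
  obtain ⟨r, hr, rfl⟩ : ∃ r, 0 < r ∧ r' = r + r := ⟨r' / 2, by positivity, by ring⟩
  set w₀ := x + ζ₀ • y
  set K := Metric.closedBall w₀ (r + r)
  have hK : IsCompact K := isCompact_closedBall _ _
  have hvK : ContinuousOn v K := hv.mono hr'D
  -- Nothing is known about `v` outside `D`; truncation makes it integrable and does not change the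
  -- integrals against the test functions used here.
  set v₀ : V → ℂ := K.indicator v
  have hv₀ : Integrable v₀ μ :=
    (integrable_indicator_iff hK.measurableSet).2 (hvK.integrableOn_compact hK)
  have hsmall : ∀ k : ℕ, 0 < r / (k + 1) ∧ r / (k + 1) ≤ r := fun k =>
    ⟨by positivity, div_le_self hr.le (by linarith [(Nat.cast_nonneg k : (0 : ℝ) ≤ k)])⟩
  let φ : ℕ → ContDiffBump (0 : V) := fun k =>
    ⟨r / (k + 1) / 2, r / (k + 1), half_pos (hsmall k).1, half_lt_self (hsmall k).1⟩
  let u : ℕ → V → ℂ := fun k =>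
    convolution v₀ ((φ k).normed μ) (ContinuousLinearMap.lsmul ℝ ℝ).flip μ
  have hu : ∀ k, Differentiable ℝ (u k) := fun k z =>
    ((φ k).hasCompactSupport_normed.hasFDerivAt_convolution_right _ hv₀.locallyIntegrable
      ((φ k).contDiff_normed (n := 1)) z).differentiableAt
  have hdu : ∀ k, ∀ z ∈ Metric.ball w₀ r, dbar (u k) z y = 0 := by
    intro k z hz
    rw [dbar_convolution μ hv₀.locallyIntegrable ((φ k).contDiff_normed (n := 1))
      (φ k).hasCompactSupport_normed, neg_eq_zero]
    set g : V → ℂ := fun t => ((φ k).normed μ (z - t) : ℂ)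
    have hgs : tsupport g ⊆ K := by
      refine closure_minimal (fun t ht => ?_) Metric.isClosed_closedBall
      have h1 : z - t ∈ Function.support ((φ k).normed μ) := fun h => ht (by simp [g, h])
      rw [(φ k).support_normed_eq] at h1
      have h2 : ‖z - t‖ < r := lt_of_lt_of_le (by simpa using h1) (hsmall k).2
      rw [Metric.mem_closedBall]
      refine (dist_triangle t z w₀).trans (add_le_add ?_ (Metric.mem_ball.1 hz).le)
      rw [dist_comm, dist_eq_norm]
      exact h2.le
    have hgd : ContDiff ℝ ∞ g :=
      Complex.ofRealCLM.contDiff.comp ((φ k).contDiff_normed.comp (contDiff_const.sub contDiff_id))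
    have hgc : HasCompactSupport g := hK.of_isClosed_subset (isClosed_tsupport g) hgs
    rw [← hw g hgd hgc (hgs.trans hr'D) y]
    refine integral_congr_ae (ae_of_all _ fun t => ?_)
    by_cases ht : t ∈ K
    · simp [v₀, ht]
    · have h0 : fderiv ℝ g t = 0 := by
        by_contra h
        exact ht (hgs (tsupport_fderiv_subset ℝ (subset_tsupport _ h)))
      simp [dbar, h0]
  have huc := hK.uniformContinuousOn_of_continuous hvK
  -- The mollifications are holomorphic on the line and converge uniformly near `w₀`, so the limit
  -- is holomorphic.
  have hlim : TendstoUniformlyOn u v atTop (Metric.ball w₀ r) := by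
    rw [Metric.tendstoUniformlyOn_iff]
    intro ε hε
    obtain ⟨δ, hδ, hδv⟩ := Metric.uniformContinuousOn_iff.1 huc (ε / 2) (half_pos hε)
    have h1 : Tendsto (fun k : ℕ => r / ((k : ℝ) + 1)) atTop (𝓝 0) := by
      have := tendsto_one_div_add_atTop_nhds_zero_nat (𝕜 := ℝ).const_mul r
      simpa [div_eq_mul_inv] using this
    filter_upwards [h1.eventually (gt_mem_nhds hδ)] with k hk z hz
    have hzK : z ∈ K := Metric.ball_subset_closedBall (Metric.ball_subset_ball (by linarith) hz)
    have h2 := (φ k).dist_normed_convolution_le (μ := μ) (g := v₀) (x₀ := z) (ε := ε / 2)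
      hv₀.aestronglyMeasurable fun t ht => by
        have htz : dist t z < r / (k + 1) := ht
        have htK : t ∈ K := by
          rw [Metric.mem_closedBall]
          exact (dist_triangle t z w₀).trans
            (add_le_add (htz.le.trans (hsmall k).2) (Metric.mem_ball.1 hz).le)
        simp only [v₀, indicator_of_mem htK, indicator_of_mem hzK]
        exact (hδv t htK z hzK (htz.trans hk)).le
    rw [← convolution_flip] at h2
    simp only [v₀, indicator_of_mem hzK] at h2
    rw [dist_comm]
    exact h2.trans_lt (half_lt_self hε)
  have hU : IsOpen {ζ : ℂ | x + ζ • y ∈ Metric.ball w₀ r} := Metric.isOpen_ball.preimage hline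
  have hlim' : TendstoLocallyUniformlyOn (fun k (ζ : ℂ) => u k (x + ζ • y))
      (fun ζ : ℂ => v (x + ζ • y)) atTop {ζ : ℂ | x + ζ • y ∈ Metric.ball w₀ r} :=
    (hlim.comp fun ζ : ℂ => x + ζ • y).tendstoLocallyUniformlyOn
  have hdiff := hlim'.differentiableOn (Eventually.of_forall fun k ζ hζ =>
    (differentiableAt_line_of_dbar_eq_zero (hu k) (hdu k _ hζ)).differentiableWithinAt) hU
  exact (hdiff.differentiableAt (hU.mem_nhds (Metric.mem_ball_self hr))).differentiableWithinAt

end Weyl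

/-! ### The growth estimate that contradicts a bounded solution. -/

/-- On the circle the logarithmic factor is constant and `b^p = 1`, so the integrand is that
constant divided by `ζ`. -/
theorem circleCoeff_powMulLog {p : ℕ} (H : ℝ → ℝ) {ρ : ℝ} (hρ : 0 < ρ) {b : ℂ} (hb : b ^ p = 1)
    (hb1 : ‖b‖ = 1) :
    circleCoeff p ρ (fun ζ => powMulLog p H 0 (ζ * b)) =
      2 * Real.pi * Complex.I * (H (Real.log ((ρ ^ 2)⁻¹)) : ℂ) := by
  have h1 : circleCoeff p ρ (fun ζ => powMulLog p H 0 (ζ * b)) =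
      ∮ z in C(0, ρ), (H (Real.log ((ρ ^ 2)⁻¹)) : ℂ) * (z - 0)⁻¹ := by
    refine circleIntegral.integral_congr hρ.le fun z hz => ?_
    have hz' : ‖z‖ = ρ := by simpa using hz
    have h0 : z ≠ 0 := Metric.ne_of_mem_sphere hz hρ.ne'
    simp only [powMulLog, norm_mul, hb1, mul_one, hz', add_zero, mul_pow, hb, sub_zero]
    field_simp
    ring
  rw [h1, circleIntegral.integral_const_mul, circleIntegral.integral_sub_center_inv _ hρ.ne']
  ring

/-- The growth bound that the logarithmic singularity would have to satisfy if
`U - ∑ i, powMulLog p H 0 (w i)` were holomorphic on lines in an `ℓ^p` ball of dimension `m ^ p`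
for a function `U` bounded by `M`. -/
theorem log_cutoff_le_of_holomorphic_sub {p m : ℕ} (hp : 1 ≤ p) (hm : 1 ≤ m) {H : ℝ → ℝ}
    (hH : IsLogCutoff H) {r ρ M : ℝ} (hρ : 0 < ρ) (hρr : ρ < r) {U : (Fin (m ^ p) → ℂ) → ℂ}
    (hUc : ContinuousOn U {w | ∑ i, ‖w i‖ ^ p < r ^ p})
    (hUM : ∀ w, ∑ i, ‖w i‖ ^ p < r ^ p → ‖U w‖ ≤ M)
    (hol : ∀ x y : Fin (m ^ p) → ℂ,
      DifferentiableOn ℂ (fun ζ : ℂ => U (x + ζ • y) - ∑ i, powMulLog p H 0 ((x + ζ • y) i))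
        {ζ | ∑ i, ‖(x + ζ • y) i‖ ^ p < r ^ p}) :
    H (Real.log (((ρ / m) ^ 2)⁻¹)) ≤ 2 * (M / ρ ^ p) + |H (Real.log ((ρ ^ 2)⁻¹))| := by
  have hr : 0 < r := hρ.trans hρr
  have hp0 : p ≠ 0 := by omega
  have : NeZero p := ⟨hp0⟩
  let _ : Fintype (rootsOfUnity p ℂ) := Fintype.ofFinite _
  have hm0 : (0 : ℝ) < m := by exact_mod_cast hm
  have hlam0 : powMulLog p H 0 0 = 0 := by simp [powMulLog, hp0]
  have hroot : ∀ b : rootsOfUnity p ℂ, ((b : ℂˣ) : ℂ) ^ p = 1 ∧ ‖((b : ℂˣ) : ℂ)‖ = 1 := fun b =>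
    ⟨(mem_rootsOfUnity' p (b : ℂˣ)).1 b.2,
      Complex.norm_eq_one_of_mem_rootsOfUnity b.2⟩
  set v : (Fin (m ^ p) → ℂ) → ℂ := fun w => U w - ∑ i, powMulLog p H 0 (w i)
  have hlamc := hH.continuous_powMulLog hp le_rfl
  -- Only the existence of a bound for `v` on the polydisc is needed; `B` does not enter the final
  -- estimate.
  obtain ⟨B, hB⟩ := hlamc.bounded_above_of_compact_support hH.hasCompactSupport_powMulLog
  -- The dimension `m^p` is chosen so that `m^p (r/m)^p = r^p`.
  have hpoly : ∀ w : Fin (m ^ p) → ℂ, (∀ i, ‖w i‖ < r / m) → ∑ i, ‖w i‖ ^ p < r ^ p := by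
    intro w hw
    calc ∑ i, ‖w i‖ ^ p < ∑ _i : Fin (m ^ p), (r / m) ^ p := by
          refine Finset.sum_lt_sum_of_nonempty ?_ fun i _ => ?_
          · exact ⟨⟨0, by positivity⟩, Finset.mem_univ _⟩
          · exact pow_lt_pow_left₀ (hw i) (norm_nonneg _) hp0
      _ = r ^ p := by
          rw [Finset.sum_const, Finset.card_univ, Fintype.card_fin, nsmul_eq_mul, div_pow]
          push_cast
          field_simp
  have hdiag := sum_circleCoeff_diagonal_eq (p := p) (v := v) (R := r / m) (ρ := ρ / m)
    (M := M + ∑ _i : Fin (m ^ p), B)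
    (fun x y => (hol x y).mono fun ζ hζ => hpoly _ fun i => by simpa using hζ i)
    (fun w hw => (norm_sub_le _ _).trans (add_le_add (hUM w (hpoly w hw))
      (norm_sum_le_of_le _ fun i _ => hB _))) (by positivity) (by gcongr)
  have hsphere : ∀ a : Fin (m ^ p) → rootsOfUnity p ℂ, ∀ ζ : ℂ, ‖ζ‖ = ρ / m →
      ∑ i, ‖(ζ • fun i => ((a i : ℂˣ) : ℂ)) i‖ ^ p < r ^ p := by
    intro a ζ hζ
    refine hpoly _ fun i => ?_
    rw [Pi.smul_apply, norm_smul, (hroot _).2, hζ, mul_one]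
    gcongr
  have hleft : ∀ a : Fin (m ^ p) → rootsOfUnity p ℂ,
      circleCoeff p (ρ / m) (fun ζ => v (ζ • fun i => ((a i : ℂˣ) : ℂ))) =
        circleCoeff p (ρ / m) (fun ζ => U (ζ • fun i => ((a i : ℂˣ) : ℂ))) -
          m ^ p * (2 * Real.pi * Complex.I * (H (Real.log (((ρ / m) ^ 2)⁻¹)) : ℂ)) := by
    intro a
    rw [circleCoeff_sub (by positivity)]
    · congr 1
      rw [circleCoeff_sum (by positivity)]
      · simp only [Pi.smul_apply, smul_eq_mul]
        rw [Finset.sum_congr rfl fun i _ => circleCoeff_powMulLog H (by positivity) (hroot (a i)).1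
          (hroot (a i)).2]
        simp
      · intro i _
        exact (hlamc.comp (by fun_prop)).continuousOn
    · exact hUc.comp (Continuous.continuousOn (by fun_prop)) fun ζ hζ =>
        hsphere a ζ (by simpa using hζ)
    · exact Continuous.continuousOn (by fun_prop)
  have haxis_sum : ∀ (i : Fin (m ^ p)) (b : rootsOfUnity p ℂ) (ζ : ℂ),
      ∑ j, ‖(ζ • (Pi.single i ((b : ℂˣ) : ℂ) : Fin (m ^ p) → ℂ)) j‖ ^ p = ‖ζ‖ ^ p := by
    intro i b ζ
    rw [Finset.sum_eq_single i]
    · simp [(hroot b).2]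
    · intro j _ hj
      simp [hj, hp0]
    · simp
  have haxis_lam : ∀ (i : Fin (m ^ p)) (b : rootsOfUnity p ℂ) (ζ : ℂ),
      ∑ j, powMulLog p H 0 ((ζ • (Pi.single i ((b : ℂˣ) : ℂ) : Fin (m ^ p) → ℂ)) j) =
        powMulLog p H 0 (ζ * ((b : ℂˣ) : ℂ)) := by
    intro i b ζ
    rw [Finset.sum_eq_single i]
    · simp
    · intro j _ hj
      simp [hj, hlam0]
    · simp
  -- Along an axis `v` is holomorphic on the full disc of radius `r`, so the circle may be enlarged
  -- from `ρ/m` to `ρ`. This saves a factor `m^p` for `U` and makes the logarithmic term independent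
  -- of `m`.
  have hright : ∀ (i : Fin (m ^ p)) (b : rootsOfUnity p ℂ),
      circleCoeff p (ρ / m) (fun ζ => v (ζ • Pi.single i ((b : ℂˣ) : ℂ))) =
        circleCoeff p ρ (fun ζ => U (ζ • Pi.single i ((b : ℂˣ) : ℂ))) -
          2 * Real.pi * Complex.I * (H (Real.log ((ρ ^ 2)⁻¹)) : ℂ) := by
    intro i b
    have hd : DifferentiableOn ℂ (fun ζ : ℂ => v (ζ • Pi.single i ((b : ℂˣ) : ℂ)))
        (Metric.ball 0 r) := by
      have h := hol 0 (Pi.single i ((b : ℂˣ) : ℂ))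
      simp only [zero_add, haxis_sum] at h
      exact h.mono fun ζ hζ => pow_lt_pow_left₀ (by simpa using hζ) (norm_nonneg _) hp0
    rw [← circleCoeff_radius_eq hd (by positivity)
      (div_le_self hρ.le (by exact_mod_cast hm)) hρr]
    simp only [v, haxis_lam]
    rw [circleCoeff_sub hρ, circleCoeff_powMulLog H hρ (hroot b).1 (hroot b).2]
    · refine hUc.comp (Continuous.continuousOn (by fun_prop)) fun ζ hζ => ?_
      have hζ' : ‖ζ‖ = ρ := by simpa using hζ
      simp only [mem_ofPred_eq, haxis_sum, hζ']
      exact pow_lt_pow_left₀ hρr hρ.le hp0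
    · exact Continuous.continuousOn (by fun_prop)
  -- The small circle costs `(ρ/m)^(-p) = m^p ρ^(-p)`, no more than the number of coordinates that
  -- carry a logarithmic term.
  have hleftn : ∀ a : Fin (m ^ p) → rootsOfUnity p ℂ,
      ‖circleCoeff p (ρ / m) (fun ζ => U (ζ • fun i => ((a i : ℂˣ) : ℂ)))‖ ≤
        2 * Real.pi * (m ^ p * (M / ρ ^ p)) := by
    intro a
    refine (norm_circleCoeff_le (by positivity) fun ζ hζ => hUM _ (hsphere a ζ hζ)).trans
      (le_of_eq ?_)
    rw [div_pow]
    field_simp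
  have hrightn : ∀ (i : Fin (m ^ p)) (b : rootsOfUnity p ℂ),
      ‖circleCoeff p ρ (fun ζ => U (ζ • Pi.single i ((b : ℂˣ) : ℂ)))‖ ≤
        2 * Real.pi * (M / ρ ^ p) := by
    intro i b
    refine norm_circleCoeff_le hρ fun ζ hζ => hUM _ ?_
    rw [haxis_sum, hζ]
    exact pow_lt_pow_left₀ hρr hρ.le hp0
  simp_rw [hleft, hright, Finset.sum_sub_distrib, Finset.sum_const, Finset.card_univ,
    nsmul_eq_mul] at hdiag
  set A : ℕ := Fintype.card (Fin (m ^ p) → rootsOfUnity p ℂ)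
  have hA : (0 : ℝ) < A := by exact_mod_cast Fintype.card_pos
  set l := H (Real.log (((ρ / m) ^ 2)⁻¹))
  set l' := H (Real.log ((ρ ^ 2)⁻¹))
  rw [Fintype.card_fin] at hdiag
  set S := ∑ a : Fin (m ^ p) → rootsOfUnity p ℂ,
    circleCoeff p (ρ / m) (fun ζ => U (ζ • fun i => ((a i : ℂˣ) : ℂ)))
  set S' := ∑ i, ∑ a : Fin (m ^ p) → rootsOfUnity p ℂ,
    circleCoeff p ρ (fun ζ => U (ζ • Pi.single i ((a i : ℂˣ) : ℂ)))
  have hS : ‖S‖ ≤ A * (2 * Real.pi * (m ^ p * (M / ρ ^ p))) := by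
    refine (norm_sum_le_of_le _ fun a _ => hleftn a).trans (le_of_eq ?_)
    simp [A]
  have hS' : ‖S'‖ ≤ m ^ p * (A * (2 * Real.pi * (M / ρ ^ p))) := by
    refine (norm_sum_le_of_le _ fun i _ =>
      norm_sum_le_of_le _ fun a _ => hrightn i (a i)).trans (le_of_eq ?_)
    simp [A]
  have key : ((A * m ^ p * (2 * Real.pi) * l : ℝ) : ℂ) * Complex.I =
      S - S' + ((A * m ^ p * (2 * Real.pi) * l' : ℝ) : ℂ) * Complex.I := by
    push_cast at hdiag ⊢
    linear_combination -hdiag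
  have hnorm := congrArg norm key
  rw [norm_mul, Complex.norm_I, mul_one, Complex.norm_real, Real.norm_eq_abs] at hnorm
  have h1 : A * m ^ p * (2 * Real.pi) * l ≤
      A * (2 * Real.pi * (m ^ p * (M / ρ ^ p))) + m ^ p * (A * (2 * Real.pi * (M / ρ ^ p))) +
        A * m ^ p * (2 * Real.pi) * |l'| := by
    refine (le_abs_self _).trans (hnorm.le.trans ((norm_add_le _ _).trans
      (add_le_add ((norm_sub_le _ _).trans (add_le_add hS hS')) (le_of_eq ?_))))
    rw [norm_mul, Complex.norm_I, mul_one, Complex.norm_real, Real.norm_eq_abs, abs_mul,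
      abs_of_pos (by positivity)]
  have hc : 0 < A * (m : ℝ) ^ p * (2 * Real.pi) := by positivity
  refine le_of_mul_le_mul_left (h1.trans (le_of_eq ?_)) hc
  ring

/-! ### Symmetry of second `∂̄`-derivatives. -/

theorem fderiv_fderiv_apply {V : Type*} [NormedAddCommGroup V] [NormedSpace ℝ V] {g : V → ℂ}
    (hg : ContDiff ℝ 2 g) (z a b : V) :
    fderiv ℝ (fun w => fderiv ℝ g w a) z b = fderiv ℝ (fun w => fderiv ℝ g w b) z a := by
  have hd : DifferentiableAt ℝ (fderiv ℝ g) z :=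
    (hg.fderiv_right (m := 1) (by norm_num)).differentiable one_ne_zero z
  have h : ∀ a b : V, fderiv ℝ (fun w => fderiv ℝ g w a) z b = fderiv ℝ (fderiv ℝ g) z b a := by
    intro a b
    rw [fderiv_clm_apply hd (differentiableAt_const a)]
    simp
  rw [h, h]
  exact (hg.contDiffAt.isSymmSndFDerivAt (by simp)) b a

section Dbar

variable {V : Type*} [NormedAddCommGroup V] [NormedSpace ℂ V] {g : V → ℂ}

theorem ContDiff.dbar (hg : ContDiff ℝ ∞ g) (v : V) : ContDiff ℝ ∞ fun z => dbar g z v := by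
  have h : ContDiff ℝ ∞ (fderiv ℝ g) := hg.fderiv_right (by simp)
  unfold _root_.dbar
  fun_prop

theorem dbar_dbar_comm (hg : ContDiff ℝ ∞ g) (z a b : V) :
    dbar (fun w => dbar g w a) z b = dbar (fun w => dbar g w b) z a := by
  have hg2 : ContDiff ℝ 2 g := hg.of_le (WithTop.coe_le_coe.2 (le_top : (2 : ℕ∞) ≤ ⊤))
  have hd : ∀ c, DifferentiableAt ℝ (fun w => fderiv ℝ g w c) z := fun c =>
    ((hg2.fderiv_right (m := 1) (by norm_num)).differentiable one_ne_zero z).clm_apply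
      (differentiableAt_const c)
  have h : ∀ a b : V, fderiv ℝ (fun w => dbar g w a) z b =
      (1 / 2) * (fderiv ℝ (fun w => fderiv ℝ g w a) z b +
        Complex.I * fderiv ℝ (fun w => fderiv ℝ g w (Complex.I • a)) z b) := by
    intro a b
    have h1 := (((hd a).hasFDerivAt.add ((hd (Complex.I • a)).hasFDerivAt.const_mul
      Complex.I)).const_mul (1 / 2 : ℂ))
    have h2 : HasFDerivAt (fun w => dbar g w a) _ z := h1
    rw [h2.fderiv]
    simp
    ring
  rw [dbar, h, h]
  rw [dbar.eq_1 (fun w => dbar g w b), h, h]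
  rw [fderiv_fderiv_apply hg2 z b a, fderiv_fderiv_apply hg2 z b (Complex.I • a),
    fderiv_fderiv_apply hg2 z (Complex.I • b) a,
    fderiv_fderiv_apply hg2 z (Complex.I • b) (Complex.I • a)]
  ring

end Dbar

/-! ### The diagonal form on `ℓ^p`: convergence, growth, smoothness, closedness. -/

section DiagonalForm

variable {p : ℕ}

/-- Young's inequality for the exponents `p/(p-1)` and `p`, obtained from Bernoulli's inequality at
`b/a - 1`. -/
theorem mul_pow_mul_le (hp : 1 ≤ p) {a b : ℝ} (ha : 0 ≤ a) (hb : 0 ≤ b) :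
    p * (a ^ (p - 1) * b) ≤ b ^ p + (p - 1) * a ^ p := by
  obtain ⟨n, rfl⟩ : ∃ n, p = n + 1 := ⟨p - 1, by omega⟩
  rcases ha.eq_or_lt with rfl | ha
  · rcases Nat.eq_zero_or_pos n with rfl | hn
    · simp
    · simp [hn.ne']
      positivity
  have h := one_add_mul_le_pow (a := b / a - 1)
    (by have := div_nonneg hb ha.le; linarith) (n + 1)
  rw [add_sub_cancel, div_pow, le_div_iff₀ (by positivity)] at h
  have e : (1 + ((n + 1 : ℕ) : ℝ) * (b / a - 1)) * a ^ (n + 1) =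
      (n + 1 : ℕ) * (a ^ n * b) - ((n + 1 : ℕ) - 1) * a ^ (n + 1) := by
    rw [pow_succ]
    field_simp
    ring
  rw [e] at h
  rw [Nat.add_sub_cancel]
  linarith

theorem norm_mul_conj_le (hp : 1 ≤ p) {φ : ℂ → ℂ} (hφ : ∀ ζ, ‖φ ζ‖ ≤ ‖ζ‖ ^ (p - 1)) (ζ ξ : ℂ) :
    ‖φ ζ * conj ξ‖ ≤ ‖ζ‖ ^ p + ‖ξ‖ ^ p := by
  rw [norm_mul, RCLike.norm_conj]
  have h1 := mul_pow_mul_le hp (norm_nonneg ζ) (norm_nonneg ξ)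
  have h2 : ‖φ ζ‖ * ‖ξ‖ ≤ ‖ζ‖ ^ (p - 1) * ‖ξ‖ := by
    gcongr
    exact hφ ζ
  have hp' : (1 : ℝ) ≤ p := by exact_mod_cast hp
  have h3 : 0 ≤ ‖ζ‖ ^ p := by positivity
  have h4 : 0 ≤ ‖ξ‖ ^ p := by positivity
  have h5 : (p : ℝ) * (‖ζ‖ ^ (p - 1) * ‖ξ‖) ≤ p * (‖ζ‖ ^ p + ‖ξ‖ ^ p) := by nlinarith
  exact h2.trans (le_of_mul_le_mul_left h5 (by linarith))

variable [Fact (1 ≤ (p : ℝ≥0∞))]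

theorem one_le_of_fact (p : ℕ) [h : Fact (1 ≤ (p : ℝ≥0∞))] : 1 ≤ p := by exact_mod_cast h.out

theorem lp_hasSum_norm_pow (z : lp (fun _ : ℕ => ℂ) (p : ℝ≥0∞)) :
    HasSum (fun ν => ‖z ν‖ ^ p) (‖z‖ ^ p) := by
  have hp := one_le_of_fact p
  have := lp.hasSum_norm (p := (p : ℝ≥0∞)) (by simpa using (by omega : 0 < p)) z
  simpa using this

theorem summable_diagonalForm {φ : ℂ → ℂ} (hφ : ∀ ζ, ‖φ ζ‖ ≤ ‖ζ‖ ^ (p - 1))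
    (z ξ : lp (fun _ : ℕ => ℂ) (p : ℝ≥0∞)) : Summable fun ν => φ (z ν) * conj (ξ ν) :=
  Summable.of_norm_bounded ((lp_hasSum_norm_pow z).add (lp_hasSum_norm_pow ξ)).summable
    fun _ => norm_mul_conj_le (one_le_of_fact p) hφ _ _

/-- The form `f(z; ξ) = ∑ φ(z_ν) ξ̄_ν` on `ℓ^p`. -/
noncomputable def diagonalForm (φ : ℂ → ℂ) (hφ : ∀ ζ, ‖φ ζ‖ ≤ ‖ζ‖ ^ (p - 1)) :
    Form01 (lp (fun _ : ℕ => ℂ) (p : ℝ≥0∞)) := fun z =>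
  { toFun := fun ξ => ∑' ν, φ (z ν) * conj (ξ ν)
    map_add' := fun ξ η => by
      rw [← (summable_diagonalForm hφ z ξ).tsum_add (summable_diagonalForm hφ z η)]
      simp [mul_add]
    map_smul' := fun c ξ => by
      rw [smul_eq_mul, ← tsum_mul_left]
      simp [mul_left_comm] }

variable {φ : ℂ → ℂ} (hφ : ∀ ζ, ‖φ ζ‖ ≤ ‖ζ‖ ^ (p - 1))

theorem hasSum_diagonalForm (z ξ : lp (fun _ : ℕ => ℂ) (p : ℝ≥0∞)) :
    HasSum (fun ν => φ (z ν) * conj (ξ ν)) (diagonalForm φ hφ z ξ) :=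
  (summable_diagonalForm hφ z ξ).hasSum

/-- Young's inequality for `|z_ν|/r` and `|ξ_ν|` sums to `(r^(p-1)/p)(1 + (p - 1)) = r^(p-1)`; the
scaling by `r` makes the constant sharp enough. -/
theorem norm_diagonalForm_le {r : ℝ} (hr : 0 < r) {z ξ : lp (fun _ : ℕ => ℂ) (p : ℝ≥0∞)}
    (hz : ‖z‖ ≤ r) (hξ : ‖ξ‖ ≤ 1) : ‖diagonalForm φ hφ z ξ‖ ≤ r ^ (p - 1) := by
  have hp := one_le_of_fact p
  have hp' : (1 : ℝ) ≤ p := by exact_mod_cast hp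
  have hp0 : (0 : ℝ) < p := by linarith
  have hsum : HasSum (fun ν => r ^ (p - 1) / p * (‖ξ ν‖ ^ p + (p - 1) / r ^ p * ‖z ν‖ ^ p))
      (r ^ (p - 1) / p * (‖ξ‖ ^ p + (p - 1) / r ^ p * ‖z‖ ^ p)) :=
    ((lp_hasSum_norm_pow ξ).add ((lp_hasSum_norm_pow z).mul_left _)).mul_left _
  refine (tsum_of_norm_bounded hsum fun ν => ?_).trans ?_
  · rw [norm_mul, RCLike.norm_conj]
    have h1 := mul_pow_mul_le hp (div_nonneg (norm_nonneg (z ν)) hr.le) (norm_nonneg (ξ ν))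
    calc ‖φ (z ν)‖ * ‖ξ ν‖ ≤ ‖z ν‖ ^ (p - 1) * ‖ξ ν‖ := by
          gcongr
          exact hφ _
      _ = r ^ (p - 1) / p * (p * ((‖z ν‖ / r) ^ (p - 1) * ‖ξ ν‖)) := by
          rw [div_pow]
          field_simp
      _ ≤ r ^ (p - 1) / p * (‖ξ ν‖ ^ p + (p - 1) * (‖z ν‖ / r) ^ p) := by gcongr
      _ = _ := by
          rw [div_pow]
          ring
  · have h2 : ‖ξ‖ ^ p ≤ 1 := pow_le_one₀ (norm_nonneg _) hξ
    have h3 : (p - 1) / r ^ p * ‖z‖ ^ p ≤ p - 1 := by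
      rw [div_mul_eq_mul_div, div_le_iff₀ (by positivity)]
      have : (0 : ℝ) ≤ p - 1 := by linarith
      gcongr
    calc _ ≤ r ^ (p - 1) / p * (1 + (p - 1)) := by gcongr
      _ = r ^ (p - 1) := by
        rw [add_sub_cancel]
        field_simp

theorem supNorm_diagonalForm_le {r : ℝ} (hr : 0 < r) :
    (diagonalForm φ hφ).supNorm (Metric.ball 0 r) ≤ ENNReal.ofReal (r ^ (p - 1)) := by
  refine iSup₂_le fun z hz => iSup₂_le fun ξ hξ => ?_
  rw [← ofReal_norm]
  exact ENNReal.ofReal_le_ofReal (norm_diagonalForm_le hφ hr (mem_ball_zero_iff.1 hz).le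
    (mem_ball_zero_iff.1 hξ).le)

theorem isClassC_diagonalForm (hφd : ContDiff ℝ (p - 1 : ℕ) φ)
    (hφb : ∀ k ≤ p - 1, ∃ C, 0 ≤ C ∧
      ∀ ζ, ‖iteratedFDeriv ℝ k φ ζ‖ ≤ C * ‖ζ‖ ^ (p - 1 - k)) :
    (diagonalForm φ hφ).IsClassC (p - 1) univ := by
  have hp := one_le_of_fact p
  let ev : ℕ → lp (fun _ : ℕ => ℂ) (p : ℝ≥0∞) →L[ℝ] ℂ := fun ν =>
    lp.evalCLM ℝ (fun _ : ℕ => ℂ) (p : ℝ≥0∞) ν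
  have hev : IsPowerSummable p ev 1 :=
    ⟨zero_le_one, fun z => (lp_hasSum_norm_pow z).summable, fun z => by
      rw [one_mul]
      exact (lp_hasSum_norm_pow z).tsum_eq.le⟩
  let L : ℂ →L[ℝ] (ℂ →L[ℝ] ℂ) :=
    (ContinuousLinearMap.lsmul ℝ ℂ (E := ℂ →L[ℝ] ℂ)).flip (Complex.conjCLE : ℂ →L[ℝ] ℂ)
  have hLd : ContDiff ℝ (p - 1 : ℕ) (L ∘ φ) := L.contDiff.comp hφd
  have h := hev.prodMap.isClassC hp (p - 1) (by omega) (G := fun q : ℂ × ℂ => (L ∘ φ) q.1 q.2)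
    ((hLd.comp contDiff_fst).clm_apply contDiff_snd) fun k hk => ?_
  · unfold Form01.IsClassC
    rw [univ_prod_univ]
    exact h
  · have h1 := exists_norm_iteratedFDeriv_apply_snd_le (f := L ∘ φ) (le_refl (p - 1)) hLd
      (fun k hk => ?_) hk
    · rwa [Nat.sub_add_cancel hp] at h1
    · obtain ⟨C, hC0, hC⟩ := hφb k hk
      refine ⟨‖L‖ * C, by positivity, fun ζ => ?_⟩
      rw [mul_assoc]
      exact (L.norm_iteratedFDeriv_comp_left hφd.contDiffAt (by exact_mod_cast hk)).trans
        (by gcongr; exact hC ζ)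

/-- Each term of the series is weakly `∂̄(λ ∘ ℓ_ν)`, and `∂̄`-derivatives of the test function
commute. The sum of the potentials need not converge, so summation and integration are interchanged
for the form itself, and the potentials appear only term by term. -/
theorem isDbarClosed_diagonalForm {H : ℝ → ℝ} (hH : IsLogCutoff H)
    (hφ : ∀ ζ, ‖powMulLogDbar p H 0 ζ‖ ≤ ‖ζ‖ ^ (p - 1)) :
    (diagonalForm (powMulLogDbar p H 0) hφ).IsDbarClosed univ := by
  intro n L _ g ⟨hg, hgc, _⟩
  have hp := one_le_of_fact p
  let ℓ : ℕ → (Fin n → ℂ) →L[ℂ] ℂ := fun ν =>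
    (lp.evalCLM ℂ (fun _ : ℕ => ℂ) (p : ℝ≥0∞) ν).comp (LinearMap.toContinuousLinearMap L)
  have hLc : Continuous L := LinearMap.continuous_of_finiteDimensional L
  have hsum : ∀ a b : Fin n → ℂ, HasSum
      (fun ν => ∫ w, powMulLogDbar p H 0 (ℓ ν w) * conj (ℓ ν a) * dbar g w b)
      (∫ w, diagonalForm (powMulLogDbar p H 0) hφ (L w) (L a) * dbar g w b) := by
    intro a b
    have hs : ∀ w, HasSum (fun ν => (‖ℓ ν w‖ ^ p + ‖ℓ ν a‖ ^ p) * ‖dbar g w b‖)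
        ((‖L w‖ ^ p + ‖L a‖ ^ p) * ‖dbar g w b‖) := fun w =>
      ((lp_hasSum_norm_pow (L w)).add (lp_hasSum_norm_pow (L a))).mul_right _
    have hdc := (hg.dbar b).continuous
    refine hasSum_integral_of_dominated_convergence
      (fun ν w => (‖ℓ ν w‖ ^ p + ‖ℓ ν a‖ ^ p) * ‖dbar g w b‖) (fun ν => ?_)
      (fun ν => ae_of_all _ fun w => ?_) (ae_of_all _ fun w => (hs w).summable) ?_
      (ae_of_all _ fun w => (hasSum_diagonalForm hφ (L w) (L a)).mul_right _)
    · have h1 := (hH.continuous_powMulLogDbar hp le_rfl).comp (ℓ ν).continuous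
      exact Continuous.aestronglyMeasurable (by fun_prop)
    · rw [norm_mul]
      gcongr
      exact norm_mul_conj_le hp hφ _ _
    · simp_rw [fun w => (hs w).tsum_eq]
      exact Continuous.integrable_of_hasCompactSupport (by fun_prop) (hgc.dbar b).norm.mul_left
  have hterm : ∀ (ν : ℕ) (a b : Fin n → ℂ),
      ∫ w, powMulLogDbar p H 0 (ℓ ν w) * conj (ℓ ν a) * dbar g w b =
        -∫ w, powMulLog p H 0 (ℓ ν w) * dbar (fun w => dbar g w b) w a := by
    intro ν a b
    rw [hH.integral_powMulLog_mul_dbar hp volume (ℓ ν) ((hg.dbar b).of_le (by simp))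
      (hgc.dbar b), neg_neg]
  intro j k
  refine (hsum _ _).unique ?_
  convert hsum (Pi.single k 1) (Pi.single j 1) using 1
  ext ν
  rw [hterm, hterm]
  simp_rw [dbar_dbar_comm hg _ (Pi.single k 1) (Pi.single j 1)]

end DiagonalForm

/-! ### Coordinate subspaces of `ℓ^p`. -/

section Coordinates

variable {p : ℕ} {ι : Type*} [Fintype ι] {k : ι → ℕ}

/-- The embedding of `ℂ^ι` into `ℓ^p` that places the `i`-th coordinate at position `k i`. -/
noncomputable def coordEmbedding (p : ℕ) (k : ι → ℕ) :
    (ι → ℂ) →ₗ[ℂ] lp (fun _ : ℕ => ℂ) (p : ℝ≥0∞) :=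
  ∑ i, (lp.lsingle (p : ℝ≥0∞) (k i)).comp (LinearMap.proj i)

theorem coordEmbedding_apply (w : ι → ℂ) (ν : ℕ) :
    coordEmbedding p k w ν = ∑ i, if ν = k i then w i else 0 := by
  classical
  have h : coordEmbedding p k w = ∑ i, lp.single (E := fun _ : ℕ => ℂ) (p : ℝ≥0∞) (k i) (w i) := by
    rw [coordEmbedding, LinearMap.sum_apply]
    rfl
  rw [h, lp.coeFn_sum, Finset.sum_apply]
  refine Finset.sum_congr rfl fun i _ => ?_
  rw [lp.single_apply, Pi.single_apply]

theorem coordEmbedding_self (hk : Function.Injective k) (w : ι → ℂ) (i : ι) :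
    coordEmbedding p k w (k i) = w i := by
  rw [coordEmbedding_apply, Finset.sum_eq_single i]
  · simp
  · intro j _ hj
    rw [if_neg fun h => hj (hk h.symm)]
  · simp

theorem coordEmbedding_of_notMem (w : ι → ℂ) {ν : ℕ} (hν : ν ∉ range k) :
    coordEmbedding p k w ν = 0 := by
  rw [coordEmbedding_apply]
  exact Finset.sum_eq_zero fun i _ => if_neg fun h => hν ⟨i, h.symm⟩

theorem injective_coordEmbedding (hk : Function.Injective k) :
    Function.Injective (coordEmbedding p k) := by
  intro w w' h
  ext i
  rw [← coordEmbedding_self (p := p) hk w i, h, coordEmbedding_self hk]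

variable [Fact (1 ≤ (p : ℝ≥0∞))]

theorem norm_coordEmbedding_pow (hk : Function.Injective k) (w : ι → ℂ) :
    ‖coordEmbedding p k w‖ ^ p = ∑ i, ‖w i‖ ^ p := by
  have hp := one_le_of_fact p
  have h1 := lp_hasSum_norm_pow (coordEmbedding p k w)
  rw [← hk.hasSum_iff fun ν hν => by
    rw [coordEmbedding_of_notMem w hν, norm_zero, zero_pow (by omega)]] at h1
  refine h1.unique ?_
  simp only [Function.comp_def, coordEmbedding_self hk]
  exact hasSum_fintype _

theorem diagonalForm_coordEmbedding {φ : ℂ → ℂ} (hφ : ∀ ζ, ‖φ ζ‖ ≤ ‖ζ‖ ^ (p - 1)) [DecidableEq ι]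
    (hk : Function.Injective k) (w : ι → ℂ) (i : ι) :
    diagonalForm φ hφ (coordEmbedding p k w) (coordEmbedding p k (Pi.single i 1)) = φ (w i) := by
  refine (hasSum_diagonalForm hφ _ _).unique ?_
  have h := hasSum_single (f := fun ν => φ (coordEmbedding p k w ν) *
    conj (coordEmbedding p k (Pi.single i 1) ν)) (k i) fun ν hν => by
      by_cases h : ν ∈ range k
      · obtain ⟨j, rfl⟩ := h
        have hj : j ≠ i := fun h => hν (by rw [h])
        simp [coordEmbedding_self hk, hj]
      · simp [coordEmbedding_of_notMem _ h]
  simpa [coordEmbedding_self hk] using h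

end Coordinates

/-! ### Non-solvability on every nonempty open set. -/

theorem integrable_mul_of_continuousOn {V : Type*} [NormedAddCommGroup V] [MeasurableSpace V]
    [OpensMeasurableSpace V] (μ : Measure V) [IsFiniteMeasureOnCompacts μ] {D : Set V}
    (hD : IsOpen D) {v h : V → ℂ} (hv : ContinuousOn v D) (hh : Continuous h)
    (hc : HasCompactSupport h) (hs : tsupport h ⊆ D) : Integrable (fun z => v z * h z) μ := by
  refine Continuous.integrable_of_hasCompactSupport (continuous_of_tsupport fun z hz => ?_)
    hc.mul_left
  have hz' : z ∈ D := hs (tsupport_mul_subset_right hz)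
  exact (hv.continuousAt (hD.mem_nhds hz')).mul hh.continuousAt

theorem tsupport_dbar_subset {V : Type*} [NormedAddCommGroup V] [NormedSpace ℂ V] (g : V → ℂ)
    (v : V) : tsupport (fun z => dbar g z v) ⊆ tsupport g := by
  refine closure_minimal (fun z hz => ?_) (isClosed_tsupport g)
  by_contra h
  have h0 : fderiv ℝ g z = 0 := by
    by_contra h'
    exact h (tsupport_fderiv_subset ℝ (subset_tsupport _ h'))
  exact hz (by simp [dbar, h0])

section NotSolvable

variable {p : ℕ} [Fact (1 ≤ (p : ℝ≥0∞))] {H : ℝ → ℝ} {Ω : Set (lp (fun _ : ℕ => ℂ) (p : ℝ≥0∞))}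
  {u : lp (fun _ : ℕ => ℂ) (p : ℝ≥0∞) → ℂ}

/-- On coordinate subspaces a weak solution differs from `∑ lam(w_j)` by a function that is
holomorphic on complex lines. -/
theorem differentiableOn_line_sub_sum (hH : IsLogCutoff H)
    (hφ : ∀ ζ, ‖powMulLogDbar p H 0 ζ‖ ≤ ‖ζ‖ ^ (p - 1)) (hΩ : IsOpen Ω) (hu : ContinuousOn u Ω)
    (hsol : IsWeakDbarSolution Ω (diagonalForm (powMulLogDbar p H 0) hφ) u) {n : ℕ}
    {k : Fin n → ℕ} (hk : Function.Injective k) (x y : Fin n → ℂ) :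
    DifferentiableOn ℂ (fun ζ : ℂ => u (coordEmbedding p k (x + ζ • y)) -
      ∑ j, powMulLog p H 0 ((x + ζ • y) j)) {ζ | coordEmbedding p k (x + ζ • y) ∈ Ω} := by
  have hp := one_le_of_fact p
  have hL : Continuous (coordEmbedding p k) := LinearMap.continuous_of_finiteDimensional _
  have hlam := hH.continuous_powMulLog hp le_rfl
  have hD : IsOpen (coordEmbedding p k ⁻¹' Ω) := hΩ.preimage hL
  have huL : ContinuousOn (fun w => u (coordEmbedding p k w)) (coordEmbedding p k ⁻¹' Ω) :=
    hu.comp hL.continuousOn fun _ h => h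
  have hv : ContinuousOn (fun w => u (coordEmbedding p k w) - ∑ j, powMulLog p H 0 (w j))
      (coordEmbedding p k ⁻¹' Ω) :=
    huL.sub (continuous_finsetSum _ fun j _ => hlam.comp (continuous_apply j)).continuousOn
  refine differentiableOn_line_of_weak_dbar_eq_zero volume hD hv (fun g hg hgc hgs y => ?_) x y
  -- Weak solutions are tested in basis directions only; conjugate-linearity of `∂̄g` then gives
  -- every direction.
  have hbasis : ∀ j, ∫ w, (u (coordEmbedding p k w) - ∑ i, powMulLog p H 0 (w i)) *
      dbar g w (Pi.single j 1) = 0 := by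
    intro j
    have hdc := (hg.dbar (Pi.single j 1)).continuous
    have hdcs := hgc.dbar (Pi.single j 1)
    have i1 := integrable_mul_of_continuousOn volume hD huL hdc hdcs
      ((tsupport_dbar_subset g _).trans hgs)
    have i2 : ∀ i : Fin n, Integrable fun w : Fin n → ℂ =>
        powMulLog p H 0 (w i) * dbar g w (Pi.single j 1) := fun i =>
      Continuous.integrable_of_hasCompactSupport
        ((hlam.comp (continuous_apply i)).mul hdc) hdcs.mul_left
    simp_rw [sub_mul, Finset.sum_mul]
    rw [integral_sub i1 (integrable_finsetSum _ fun i _ => i2 i),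
      integral_finsetSum _ fun i _ => i2 i, hsol n _ (injective_coordEmbedding hk) g
      ⟨hg, hgc, hgs⟩ j]
    simp_rw [diagonalForm_coordEmbedding hφ hk]
    have h1 := fun i => hH.integral_powMulLog_mul_dbar hp volume
      (ContinuousLinearMap.proj (R := ℂ) (φ := fun _ : Fin n => ℂ) i) (hg.of_le (by simp)) hgc
      (Pi.single j 1)
    simp only [ContinuousLinearMap.proj_apply] at h1
    simp_rw [h1]
    rw [Finset.sum_eq_single j]
    · simp
    · intro i _ hi
      simp [hi]
    · simp
  have hdecomp : ∀ w, dbar g w y = ∑ j, conj (y j) * dbar g w (Pi.single j 1) := by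
    intro w
    have h1 : y = ∑ j, y j • (Pi.single j 1 : Fin n → ℂ) := by
      ext i
      simp [Finset.sum_apply, Pi.single_apply]
    change dbarLinear g w y = ∑ j, conj (y j) * dbarLinear g w (Pi.single j 1)
    conv_lhs => rw [h1]
    rw [map_sum]
    simp
  simp_rw [hdecomp, Finset.mul_sum]
  rw [integral_finsetSum]
  · refine Finset.sum_eq_zero fun j _ => ?_
    simp_rw [mul_left_comm _ (conj (y j))]
    rw [integral_const_mul, hbasis, mul_zero]
  · intro j _
    simp_rw [mul_left_comm _ (conj (y j))]
    exact (integrable_mul_of_continuousOn volume hD hv (hg.dbar _).continuous (hgc.dbar _)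
      ((tsupport_dbar_subset g _).trans hgs)).const_mul _

/-- Finite sequences are dense because `p < ∞`. A finitely supported centre leaves all coordinates
from `N` on free for the estimate. -/
theorem exists_finite_support_mem (hΩ : IsOpen Ω) (hne : Ω.Nonempty) :
    ∃ z₀ ∈ Ω, ∃ N : ℕ, ∀ ν, N ≤ ν → z₀ ν = 0 := by
  obtain ⟨z, hz⟩ := hne
  have h := (lp.hasSum_single (ENNReal.natCast_ne_top p) z).tendsto_sum_nat
  obtain ⟨N, hN⟩ := (h.eventually (hΩ.mem_nhds hz)).exists
  refine ⟨_, hN, N, fun ν hν => ?_⟩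
  rw [lp.coeFn_sum, Finset.sum_apply]
  refine Finset.sum_eq_zero fun i hi => ?_
  have := Finset.mem_range.1 hi
  rw [lp.single_apply_ne _ _ _ (by omega)]

theorem not_dbarSolvableOn_diagonalForm (hH : IsLogCutoff H)
    (hφ : ∀ ζ, ‖powMulLogDbar p H 0 ζ‖ ≤ ‖ζ‖ ^ (p - 1)) (hΩ : IsOpen Ω) (hne : Ω.Nonempty) :
    ¬ DbarSolvableOn Ω (diagonalForm (powMulLogDbar p H 0) hφ) := by
  rintro ⟨u, hu, hsol⟩
  have hp := one_le_of_fact p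
  obtain ⟨z₀, hz₀, N, hN⟩ := exists_finite_support_mem hΩ hne
  have hnhds : {z | z ∈ Ω ∧ ‖u z‖ < ‖u z₀‖ + 1} ∈ 𝓝 z₀ :=
    inter_mem (hΩ.mem_nhds hz₀)
      ((hu.continuousAt (hΩ.mem_nhds hz₀)).norm.eventually (gt_mem_nhds (lt_add_one _)))
  obtain ⟨r, hr, hball⟩ := Metric.mem_nhds_iff.1 hnhds
  set M := ‖u z₀‖ + 1
  -- The constants `M` and `r` do not depend on `m`: one ball of `ℓ^p` contains the balls of all the
  -- dimensions `m^p`.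
  have hbound : ∀ m : ℕ, 1 ≤ m → H (Real.log (((r / 2 / m) ^ 2)⁻¹)) ≤
      2 * (M / (r / 2) ^ p) + |H (Real.log (((r / 2) ^ 2)⁻¹))| := by
    intro m hm
    let J := coordEmbedding p fun i : Fin (m ^ p) => N + i
    have hinj : Function.Injective fun i : Fin (m ^ p) => N + (i : ℕ) := fun i j h =>
      Fin.ext (Nat.add_left_cancel h)
    have hJ : ∀ w, ∑ i, ‖w i‖ ^ p < r ^ p → z₀ + J w ∈ Metric.ball z₀ r := by
      intro w hw
      rw [← norm_coordEmbedding_pow hinj w] at hw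
      have := lt_of_pow_lt_pow_left₀ p hr.le hw
      simpa [J] using this
    have hJc : Continuous J := LinearMap.continuous_of_finiteDimensional _
    refine log_cutoff_le_of_holomorphic_sub (U := fun w => u (z₀ + J w)) (r := r) (M := M) hp hm hH
      (half_pos hr) (half_lt_self hr) ?_ (fun w hw => (hball (hJ w hw)).2.le) fun x y => ?_
    · exact hu.comp (continuous_const.add hJc).continuousOn fun w hw => (hball (hJ w hw)).1
    -- Weak solutions are defined on linear subspaces, whereas `z₀ + J w` runs through an affine
    -- one. It lies in the span of the first `N + m^p` coordinates, where the potential splits into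
    -- a constant from `z₀` and the sum over `w`.
    · let X := z₀ + J x
      let Y := J y
      have hJν : ∀ w ν, N + m ^ p ≤ ν → J w ν = 0 := fun w ν hν =>
        coordEmbedding_of_notMem w (by
          rintro ⟨i, hi⟩
          have := i.2
          dsimp only at hi
          omega)
      have hE : ∀ Z : lp (fun _ : ℕ => ℂ) (p : ℝ≥0∞), (∀ ν, N + m ^ p ≤ ν → Z ν = 0) →
          coordEmbedding p (fun i : Fin (N + m ^ p) => (i : ℕ)) (fun i => Z i) = Z := by
        intro Z hZ
        ext ν
        rcases lt_or_ge ν (N + m ^ p) with h | h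
        · exact coordEmbedding_self Fin.val_injective (fun i => Z i) ⟨ν, h⟩
        · rw [hZ ν h]
          exact coordEmbedding_of_notMem _ (by
            rintro ⟨i, hi⟩
            have := i.2
            dsimp only at hi
            omega)
      have hd := differentiableOn_line_sub_sum hH hφ hΩ hu hsol
        (k := fun i : Fin (N + m ^ p) => (i : ℕ)) Fin.val_injective (fun i => (X i : ℂ))
        (fun i => (Y i : ℂ))
      have hXY : ∀ ζ : ℂ, ((fun i : Fin (N + m ^ p) => (X i : ℂ)) +
          ζ • fun i : Fin (N + m ^ p) => (Y i : ℂ)) =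
          fun i : Fin (N + m ^ p) => ((X + ζ • Y) i : ℂ) := fun ζ => rfl
      have hXY' : ∀ ζ : ℂ, X + ζ • Y = z₀ + J (x + ζ • y) := by
        intro ζ
        simp only [X, Y, map_add, map_smul, add_assoc]
      have hsupp : ∀ w ν, N + m ^ p ≤ ν → (z₀ + J w) ν = 0 := by
        intro w ν hν
        rw [lp.coeFn_add, Pi.add_apply, hN ν (by omega), hJν w ν hν, add_zero]
      have hsum : ∀ w, ∑ j : Fin (N + m ^ p), powMulLog p H 0 ((z₀ + J w) j) =
          (∑ ν ∈ Finset.range N, powMulLog p H 0 (z₀ ν)) + ∑ i, powMulLog p H 0 (w i) := by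
        intro w
        rw [Finset.sum_range fun ν => powMulLog p H 0 (z₀ ν), Fin.sum_univ_add]
        congr 1
        · refine Finset.sum_congr rfl fun i _ => ?_
          rw [lp.coeFn_add, Pi.add_apply]
          have : J w (Fin.castAdd (m ^ p) i : ℕ) = 0 := coordEmbedding_of_notMem w (by
            rintro ⟨j, hj⟩
            have := i.2
            simp only [Fin.val_castAdd] at hj
            omega)
          rw [this, add_zero]
          rfl
        · refine Finset.sum_congr rfl fun i _ => ?_
          rw [lp.coeFn_add, Pi.add_apply]
          have h1 : J w (Fin.natAdd N i : ℕ) = w i := coordEmbedding_self hinj w i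
          rw [h1, hN _ (by simp), zero_add]
      simp only [hXY, hXY', hE _ (hsupp _), hsum] at hd
      have hd' := (hd.add_const (∑ ν ∈ Finset.range N, powMulLog p H 0 (z₀ ν)))
      refine (hd'.congr fun ζ _ => ?_).mono fun ζ hζ => (hball (hJ _ hζ)).1
      ring
  -- The left side of the bound grows like `log log m`.
  have hlim : Tendsto (fun m : ℕ => H (Real.log (((r / 2 / m) ^ 2)⁻¹))) atTop atTop := by
    have h1 : Tendsto (fun m : ℕ => Real.log (((r / 2 / (m : ℝ)) ^ 2)⁻¹)) atTop atTop := by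
      refine Real.tendsto_log_atTop.comp ?_
      have h2 : Tendsto (fun m : ℕ => ((m : ℝ) / (r / 2)) ^ 2) atTop atTop :=
        (tendsto_pow_atTop two_ne_zero).comp
          (tendsto_natCast_atTop_atTop.atTop_div_const (half_pos hr))
      refine h2.congr fun m => ?_
      rw [← inv_pow, inv_div]
    exact (Real.tendsto_log_atTop.comp h1).congr' ((h1.eventually hH.eventually_eq_log).mono
      fun m hm => hm.symm)
  obtain ⟨m, h1, h2⟩ := ((hlim.eventually (eventually_gt_atTop
    (2 * (M / (r / 2) ^ p) + |H (Real.log (((r / 2) ^ 2)⁻¹))|))).and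
      (eventually_ge_atTop 1)).exists
  exact absurd (hbound m h2) (not_le.2 h1)

end NotSolvable

/-! ### The theorem. -/

theorem theorem9p1 (p : ℕ) [Fact (1 ≤ (p : ℝ≥0∞))] :
    ∃ (lam φ : ℂ → ℂ) (f : Form01 (lp (fun _ : ℕ => ℂ) (p : ℝ≥0∞))),
      -- `lam` is compactly supported, `C^p` off `0`, and `ζ^p log log |ζ|⁻²` near `0`
      HasCompactSupport lam ∧
      ContDiffOn ℝ p lam {0}ᶜ ∧
      (∀ᶠ ζ in 𝓝 (0 : ℂ), lam ζ = ζ ^ p * (Real.log (Real.log ((‖ζ‖ ^ 2)⁻¹)) : ℝ)) ∧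
      -- `φ = ∂lam/∂ζ̄`, extended by `0` to the origin, and `f(z; ξ) = ∑ φ(z_ν) ξ̄_ν`
      (∀ ζ : ℂ, ζ ≠ 0 → φ ζ = dbar lam ζ 1) ∧
      φ 0 = 0 ∧
      (∀ z ξ : lp (fun _ : ℕ => ℂ) (p : ℝ≥0∞),
        HasSum (fun ν : ℕ => φ (z ν) * starRingEnd ℂ (ξ ν)) (f z ξ)) ∧
      -- `f` is a closed form of class `C^(p-1)` with the growth bound
      f.IsClassC (p - 1) univ ∧
      f.IsDbarClosed univ ∧
      (∀ r : ℝ, 0 < r → f.supNorm (Metric.ball 0 r) ≤ ENNReal.ofReal (r ^ (p - 1))) ∧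
      -- and it is not exact on any nonempty open set
      (∀ Ω : Set (lp (fun _ : ℕ => ℂ) (p : ℝ≥0∞)), IsOpen Ω → Ω.Nonempty →
        ¬ DbarSolvableOn Ω f) := by
  have hp := one_le_of_fact p
  obtain ⟨H, h1, h2, h3, h4⟩ := exists_smooth_log_cutoff
  have hH : IsLogCutoff H := ⟨h1, h2, h3, h4⟩
  have hφ := hH.norm_powMulLogDbar_le hp (le_refl (0 : ℝ))
  have hK := hH.isDecayingProfile_deriv
  have hab : ((p : ℕ) : ℤ) + (-1 : ℤ) = ((p - 1 : ℕ) : ℤ) := by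
    rw [Nat.cast_sub hp]
    push_cast
    ring
  have hφeq : powMulLogDbar p H 0 = -logPower p (-1) (deriv H) :=
    funext fun ζ => IsLogCutoff.powMulLogDbar_zero_eq ζ
  refine ⟨powMulLog p H 0, powMulLogDbar p H 0, diagonalForm _ hφ,
    hH.hasCompactSupport_powMulLog, ?_, ?_, ?_, by simp [powMulLogDbar],
    hasSum_diagonalForm hφ, ?_, isDbarClosed_diagonalForm hH hφ,
    fun r hr => supNorm_diagonalForm_le hφ hr,
    fun Ω hΩ hne => not_dbarSolvableOn_diagonalForm hH hφ hΩ hne⟩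
  · intro ζ hζ
    have : 0 < ‖ζ‖ := norm_pos_iff.2 hζ
    exact ((hH.contDiffAt_powMulLog (by positivity)).of_le
      (by exact_mod_cast le_top)).contDiffWithinAt
  -- `H` is the logarithm for large arguments, that is, on a punctured neighbourhood of zero; at
  -- zero both sides vanish because `p ≥ 1`.
  · have h5 : ∀ᶠ ζ in 𝓝[≠] (0 : ℂ), powMulLog p H 0 ζ =
        ζ ^ p * (Real.log (Real.log ((‖ζ‖ ^ 2)⁻¹)) : ℝ) := by
      filter_upwards [IsDecayingProfile.tendsto_log_inv_sq.eventually h3] with ζ hζ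
      rw [powMulLog, add_zero, hζ]
    filter_upwards [eventually_nhdsWithin_iff.1 h5] with ζ hζ
    by_cases h0 : ζ = 0
    · simp [h0, powMulLog, zero_pow (show p ≠ 0 by omega)]
    · exact hζ h0
  · intro ζ hζ
    have : 0 < ‖ζ‖ := norm_pos_iff.2 hζ
    obtain ⟨A, hA⟩ := hasFDerivAt_powMulLog (p := p) (ε := 0) (ζ := ζ) hH.differentiable
      (by positivity)
    exact (dbar_eq_of_hasFDerivAt hA).symm
  · refine isClassC_diagonalForm hφ ?_ fun k hk => ?_
    · rw [hφeq]
      exact (hK.contDiff_logPower hab).neg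
    · obtain ⟨C, hC0, hC⟩ := hK.exists_norm_iteratedFDeriv_logPower_le hab hk
      refine ⟨C, hC0, fun ζ => ?_⟩
      rw [hφeq, iteratedFDeriv_neg_apply, norm_neg]
      exact hC ζ
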